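/- Let $M$ be a smooth $m$-manifold and $\mathscr E\to M$ a smooth real vector bundle of rank $n\ge 1$ with a Finsler metric $F$, i.e. a function $F:\mathscr E\to[0,\infty)$ that is smooth on $\mathscr E\setminus 0$, satisfies $F(\lambda y)=\lambda F(y)$ for $\lambda>0$, and has positive definite Hessian $\frac12[F^2]_{y^iy^j}$ on $\mathscr E\setminus 0$. Let $\pi:S\mathscr E\to M$ be the projective sphere bundle, whose points are the rays $[y]$ of nonzero vectors $y\in\mathscr E_x$. The pull-back bundle $\pi^*\mathscr E$ carries the tautological section $\ell_{(x,[y])}=y/F(y)$, the metric $g_{ij}=\frac12[F^2]_{y^iy^j}$ and the Cartan tensor $A_{ijk}=\frac F4[F^2]_{y^iy^jy^k}$; put $A^j_{ik}=g^{jl}A_{lik}$. Fix an Ehresmann connection on $S\mathscr E$, i.e. a smooth splitting $T(S\mathscr E)=H\oplus V$ with $V=\ker d\pi$. Let $\{\mathfrak s_i\}$ be the local frame of $\pi^*\mathscr E$ pulled back from a local frame of $\mathscr E$, let $(x^A,y^i)$ be the corresponding local (homogeneous) coordinates of $S\mathscr E$, and let $\delta y^k=(dy^k+N^k_Adx^A)/F$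 be the vertical coframe (only its class modulo multiples of $\ell^k$ matters below, since $A$ annihilates $\ell$; one may take for $\delta y^k(\xi)$ the derivative of $\ell^k$ along the vertical part of $\xi$). Let $D$ be a smooth connection on $\pi^*\mathscr E$ compatible with $g$, and let $\gamma^j_{iA}dx^A$ be the horizontal part of its connection form, $D\mathfrak s_i=(\gamma^j_{iA}dx^A+\varrho^j_{ik}\delta y^k)\otimes\mathfrak s_j$. For $c\in\mathbb R$ let $\nabla$ be the modified connection with constant $c$, $$\nabla\mathfrak s_i=\bigl(\gamma^j_{iA}\,dx^A+c\,A^j_{ik}\,\delta y^k\bigr)\otimes\mathfrak s_j .$$ Let $e_1,\dots,e_n$ be a smooth $g$-orthonormal frame of $\pi^*\mathscr E$ over an open set $W\subset S\mathscr E$ with $e_n=\ell$, and let $\varpi_i^j$ be the connection forms, $\nabla e_i=\varpi_i^j\otimes e_j$. For $x\in M$ let $S_x\mathscr E=\pi^{-1}(x)$, let $i_x:S_x\mathscr E\hookrightarrow S\mathscr E$ be the inclusion, and give $S_x\mathscr E$ the Riemannian metric induced by $F$, i.e. $(v,w)\mapsto g_p(d\ell(v),d\ell(w))$ at $p$, where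 $\ell:S_x\mathscr E\to\mathscr E_x$ is the embedding onto the indicatrix $\{F=1\}$. Given an orientation of $\mathscr E_x$, orient $S_x\mathscr E$ by the rule "outward normal first" (the outward normal at $p$ being $\ell_p$), and let $d\nu_x$ be its Riemannian volume form. **Proposition.** For every $c\in\mathbb R$, every $x\in M$ and every orientation of $\mathscr E_x$, at each point $p\in S_x\mathscr E$ with $i_x(p)\in W$ at which the basis $(e_1,\dots,e_n)$ of $\mathscr E_x$ is positively oriented, $$d\nu_x=i_x^*\bigl(\varpi^n_1\wedge\cdots\wedge\varpi^n_{n-1}\bigr).$$ -/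

import Mathlib

open Bundle Module Metric
open scoped Manifold ContDiff Topology Bundle

set_option linter.unusedSectionVars false

noncomputable section
namespace FinslerGBC

/-- The model fibre `ℝ^{r+1}`. -/
abbrev Vec (r : ℕ) : Type := EuclideanSpace ℝ (Fin (r + 1))

/-- The unit sphere of the model fibre. -/
abbrev Sph (r : ℕ) : Type := sphere (0 : Vec r) 1

/-- Radial projection `v ↦ v / ‖v‖` onto the unit sphere (junk value at `0`). -/
def radial {r : ℕ} (v : Vec r) : Sph r :=
  if h : v = 0 then ⟨EuclideanSpace.single 0 1, by simp⟩
  else ⟨‖v‖⁻¹ • v, by simp [norm_smul, h]⟩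

theorem radial_coe {r : ℕ} {v : Vec r} (h : v ≠ 0) : (radial v : Vec r) = ‖v‖⁻¹ • v := by
  simp [radial, h]

theorem radial_self {r : ℕ} (s : Sph r) : radial (s : Vec r) = s := by
  have h : (s : Vec r) ≠ 0 := ne_zero_of_mem_unit_sphere s
  apply Subtype.ext
  rw [radial_coe h]; simp

theorem radial_eq_of_sameRay {r : ℕ} {v w : Vec r} (hv : v ≠ 0) (hw : w ≠ 0)
    (h : SameRay ℝ v w) : radial v = radial w := by
  apply Subtype.ext
  rw [radial_coe hv, radial_coe hw, (sameRay_iff_inv_norm_smul_eq_of_ne hv hw).1 h]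

theorem contMDiffAt_radial {r : ℕ} {v : Vec r} (h : v ≠ 0) :
    ContMDiffAt 𝓘(ℝ, Vec r) (𝓡 r) ∞ (radial : Vec r → Sph r) v := by
  have : Fact (finrank ℝ (Vec r) = r + 1) := ⟨finrank_euclideanSpace_fin⟩
  let U : TopologicalSpace.Opens (Vec r) := ⟨{0}ᶜ, isOpen_compl_singleton⟩
  have hs : ContMDiff 𝓘(ℝ, Vec r) 𝓘(ℝ, Vec r) ∞
      (fun x : U ↦ ‖(x : Vec r)‖⁻¹ • (x : Vec r)) := by
    intro x
    have hx : (x : Vec r) ≠ 0 := x.2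
    have h1 : ContDiffAt ℝ ∞ (fun y : Vec r ↦ ‖y‖⁻¹ • y) (x : Vec r) :=
      ((contDiffAt_norm ℝ hx).inv (norm_ne_zero_iff.2 hx)).smul contDiffAt_id
    exact contMDiffAt_subtype_iff.2 h1.contMDiffAt
  have hmem : ∀ x : U, ‖(x : Vec r)‖⁻¹ • (x : Vec r) ∈ sphere (0 : Vec r) 1 := by
    intro x
    have hx : (x : Vec r) ≠ 0 := x.2
    simp [norm_smul, hx]
  have h2 := hs.codRestrict_sphere (n := r) hmem
  have h3 : (Set.codRestrict _ _ hmem : U → Sph r) = fun x : U ↦ radial (x : Vec r) := by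
    funext x
    have hx : (x : Vec r) ≠ 0 := x.2
    exact Subtype.ext (radial_coe hx).symm
  rw [h3] at h2
  exact contMDiffAt_subtype_iff.1 (h2 ⟨v, h⟩)

section SphereBundle

variable (r : ℕ) {M : Type*} (E : M → Type*) [∀ x, AddCommGroup (E x)] [∀ x, Module ℝ (E x)]

/-- The fibre `S_xE` of the projective sphere bundle: the set of rays `[y]`, i.e. of nonzero
vectors of `E x` up to positive factors. -/
def SphereFibre (_r : ℕ) {M : Type*} (E : M → Type*) [∀ x, AddCommGroup (E x)]
    [∀ x, Module ℝ (E x)] (x : M) : Type _ := Module.Ray ℝ (E x)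

/-- The projective sphere bundle `SE`, as a set. -/
abbrev SphereBundle : Type _ := TotalSpace (Sph r) (SphereFibre r E)

variable {r E}

/-- A nonzero vector representing a ray. -/
def SphereFibre.rep {x : M} (p : SphereFibre r E x) : E x := Module.Ray.someVector (R := ℝ) p

theorem SphereFibre.rep_ne_zero {x : M} (p : SphereFibre r E x) : p.rep ≠ 0 :=
  Module.Ray.someVector_ne_zero (R := ℝ) p

/-- The ray `[y]` spanned by a nonzero vector `y`. -/
def SphereFibre.mk {x : M} (y : E x) (hy : y ≠ 0) : SphereFibre r E x := rayOfNeZero ℝ y hy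

theorem SphereFibre.mk_rep {x : M} (p : SphereFibre r E x) :
    SphereFibre.mk p.rep p.rep_ne_zero = p := Module.Ray.someVector_ray (R := ℝ) p

theorem SphereFibre.mk_eq_iff {x : M} {y z : E x} (hy : y ≠ 0) (hz : z ≠ 0) :
    (SphereFibre.mk y hy : SphereFibre r E x) = SphereFibre.mk z hz ↔ SameRay ℝ y z :=
  ray_eq_iff hy hz

variable [TopologicalSpace M] [∀ x, TopologicalSpace (E x)]
  [TopologicalSpace (TotalSpace (Vec r) E)] [FiberBundle (Vec r) E] [VectorBundle ℝ (Vec r) E]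

section
variable (e : Trivialization (Vec r) (π (Vec r) E)) [MemTrivializationAtlas e]

theorem triv_ne_zero {x : M} (hx : x ∈ e.baseSet) {y : E x} (hy : y ≠ 0) :
    (e ⟨x, y⟩).2 ≠ 0 := by
  have := (e.continuousLinearEquivAt ℝ x hx).map_ne_zero_iff.2 hy
  simpa using this

theorem triv_symm_ne_zero {x : M} (hx : x ∈ e.baseSet) {v : Vec r} (hv : v ≠ 0) :
    e.symm x v ≠ 0 := by
  have := (e.continuousLinearEquivAt ℝ x hx).symm.map_ne_zero_iff.2 hv
  simpa using this

theorem triv_sameRay {x : M} (hx : x ∈ e.baseSet) {y z : E x} (h : SameRay ℝ y z) :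
    SameRay ℝ (e ⟨x, y⟩).2 (e ⟨x, z⟩).2 := by
  have := h.map (e.continuousLinearEquivAt ℝ x hx).toLinearEquiv.toLinearMap
  simpa using this

theorem SphereFibre.nonempty (x : M) : Nonempty (SphereFibre r E x) := by
  have hx := mem_baseSet_trivializationAt (Vec r) E x
  refine ⟨SphereFibre.mk ((trivializationAt (Vec r) E x).symm x (EuclideanSpace.single 0 1))
    (triv_symm_ne_zero _ hx ?_)⟩
  simp

open Classical in
/-- The local trivialisation `(x, [y]) ↦ (x, e y / ‖e y‖)` of the projective sphere bundle
induced by a local trivialisation `e` of the vector bundle. -/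
def spherePretriv : Pretrivialization (Sph r) (π (Sph r) (SphereFibre r E)) where
  toFun z := (z.1, radial (e ⟨z.1, z.2.rep⟩).2)
  invFun q := ⟨q.1, if h : q.1 ∈ e.baseSet then
      SphereFibre.mk (e.symm q.1 q.2)
        (triv_symm_ne_zero e h (ne_zero_of_mem_unit_sphere q.2))
    else (SphereFibre.nonempty q.1).some⟩
  source := π (Sph r) (SphereFibre r E) ⁻¹' e.baseSet
  target := e.baseSet ×ˢ Set.univ
  map_source' z hz := by exact ⟨hz, trivial⟩
  map_target' q hq := hq.1
  left_inv' := by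
    rintro ⟨x, p⟩ hx
    have hx : x ∈ e.baseSet := hx
    have h0 := triv_ne_zero e hx p.rep_ne_zero
    simp only [hx, dite_true]
    congr 1
    conv_rhs => rw [← p.mk_rep]
    rw [SphereFibre.mk_eq_iff, radial_coe h0]
    have h1 : e.symm x (‖(e ⟨x, p.rep⟩).2‖⁻¹ • (e ⟨x, p.rep⟩).2)
        = ‖(e ⟨x, p.rep⟩).2‖⁻¹ • p.rep := by
      rw [← e.symmₗ_apply (R := ℝ), map_smul, e.symmₗ_apply (R := ℝ)]
      · simp [e.symm_apply_apply_mk hx]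
      all_goals exact hx
    rw [h1]
    exact SameRay.sameRay_pos_smul_left _ (by positivity)
  right_inv' := by
    rintro ⟨x, s⟩ ⟨hx, -⟩
    have hx : x ∈ e.baseSet := hx
    have hs := ne_zero_of_mem_unit_sphere s
    have h0 := triv_symm_ne_zero e hx hs
    simp only [hx, dite_true, Prod.mk.injEq, true_and]
    have h1 : SameRay ℝ (SphereFibre.mk (r := r) (e.symm x s) h0).rep (e.symm x s) := by
      rw [← SphereFibre.mk_eq_iff (r := r) (SphereFibre.rep_ne_zero _) h0, SphereFibre.mk_rep]
    rw [radial_eq_of_sameRay (triv_ne_zero e hx (SphereFibre.rep_ne_zero _))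
      (triv_ne_zero e hx h0) (triv_sameRay e hx h1)]
    simpa [hx] using radial_self s
  open_target := e.open_baseSet.prod isOpen_univ
  baseSet := e.baseSet
  open_baseSet := e.open_baseSet
  source_eq := rfl
  target_eq := rfl
  proj_toFun _ _ := rfl

variable (e' : Trivialization (Vec r) (π (Vec r) E)) [MemTrivializationAtlas e']

theorem spherePretriv_change {q : M × Sph r} (h : q.1 ∈ e.baseSet) (h' : q.1 ∈ e'.baseSet) :
    spherePretriv e' ((spherePretriv e).toPartialEquiv.symm q)
      = (q.1, radial (e.coordChangeL ℝ e' q.1 (q.2 : Vec r))) := by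
  obtain ⟨x, s⟩ := q
  have h : x ∈ e.baseSet := h
  have h' : x ∈ e'.baseSet := h'
  have hs := ne_zero_of_mem_unit_sphere s
  have h0 := triv_symm_ne_zero e h hs
  have h1 : SameRay ℝ (SphereFibre.mk (r := r) (e.symm x s) h0).rep (e.symm x s) := by
    rw [← SphereFibre.mk_eq_iff (r := r) (SphereFibre.rep_ne_zero _) h0, SphereFibre.mk_rep]
  have h2 : (spherePretriv e).toPartialEquiv.symm (x, s)
      = (⟨x, SphereFibre.mk (e.symm x s) h0⟩ : SphereBundle r E) := by
    classical
    change (⟨x, if h : x ∈ e.baseSet then _ else _⟩ : SphereBundle r E) = _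
    simp only [h, dite_true]
  rw [h2]
  change (x, radial (e' ⟨x, (SphereFibre.mk (r := r) (e.symm x s) h0).rep⟩).2) = _
  rw [radial_eq_of_sameRay (triv_ne_zero e' h' (SphereFibre.rep_ne_zero _))
      (triv_ne_zero e' h' h0) (triv_sameRay e' h' h1), e.coordChangeL_apply e' ⟨h, h'⟩]

theorem coordChange_ne_zero {x : M} {v : Vec r} (hv : v ≠ 0) :
    e.coordChangeL ℝ e' x v ≠ 0 :=
  (e.coordChangeL ℝ e' x).map_ne_zero_iff.2 hv

theorem continuousOn_spherePretriv_change :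
    ContinuousOn (spherePretriv e' ∘ (spherePretriv e).toPartialEquiv.symm)
      ((e.baseSet ∩ e'.baseSet) ×ˢ Set.univ) := by
  have h1 : ContinuousOn (fun q : M × Sph r ↦
      (e.coordChangeL ℝ e' q.1 : Vec r →L[ℝ] Vec r) (q.2 : Vec r))
      ((e.baseSet ∩ e'.baseSet) ×ˢ Set.univ) :=
    ((continuousOn_coordChange ℝ e e').comp continuousOn_fst (fun q hq ↦ hq.1)).clm_apply
      (by fun_prop)
  have h2 : ContinuousOn (fun q : M × Sph r ↦
      (q.1, radial (e.coordChangeL ℝ e' q.1 (q.2 : Vec r))))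
      ((e.baseSet ∩ e'.baseSet) ×ˢ Set.univ) := by
    refine continuousOn_fst.prodMk fun q hq ↦ ?_
    exact ContinuousAt.comp_continuousWithinAt (f := fun q : M × Sph r ↦
        e.coordChangeL ℝ e' q.1 (q.2 : Vec r)) (contMDiffAt_radial (coordChange_ne_zero e e'
      (ne_zero_of_mem_unit_sphere q.2))).continuousAt (h1 q hq)
  exact h2.congr fun q hq ↦ spherePretriv_change e e' hq.1.1 hq.1.2

end

/-- `S_xE` carries the topology of the sphere, transported by a trivialisation. -/
instance (x : M) : TopologicalSpace (SphereFibre r E x) :=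
  TopologicalSpace.induced
    (fun p ↦ radial (trivializationAt (Vec r) E x ⟨x, p.rep⟩).2) inferInstance

variable (r E) in
/-- The projective sphere bundle as a fibre bundle, with the induced trivialisations. -/
def spherePrebundle : FiberPrebundle (Sph r) (SphereFibre r E) where
  pretrivializationAtlas := {f | ∃ (e : Trivialization (Vec r) (π (Vec r) E))
    (_ : MemTrivializationAtlas e), f = spherePretriv e}
  pretrivializationAt x := spherePretriv (trivializationAt (Vec r) E x)
  mem_base_pretrivializationAt x := mem_baseSet_trivializationAt (Vec r) E x
  pretrivialization_mem_atlas x := ⟨_, inferInstance, rfl⟩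
  continuous_trivChange := by
    rintro _ ⟨e, he, rfl⟩ _ ⟨e', he', rfl⟩
    refine (continuousOn_spherePretriv_change e' e).mono ?_
    rintro ⟨x, s⟩ ⟨hx, hx'⟩
    exact ⟨⟨hx.1, hx'⟩, trivial⟩
  totalSpaceMk_isInducing x := by
    have h : Topology.IsInducing (fun p : SphereFibre r E x ↦
      radial (trivializationAt (Vec r) E x ⟨x, p.rep⟩).2) := ⟨rfl⟩
    exact (isInducing_prodMkRight x).comp h

instance : TopologicalSpace (SphereBundle r E) := (spherePrebundle r E).totalSpaceTopology

instance : FiberBundle (Sph r) (SphereFibre r E) := (spherePrebundle r E).toFiberBundle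

variable {m : ℕ} [ChartedSpace (EuclideanSpace ℝ (Fin m)) M]

/-- `SE` is modelled on `ℝ^m × ℝ^r`. -/
instance : ChartedSpace (ModelProd (EuclideanSpace ℝ (Fin m)) (EuclideanSpace ℝ (Fin r)))
    (SphereBundle r E) :=
  ChartedSpace.comp _ (M × Sph r) _



/-- The change of trivialisations of the sphere bundle is smooth. -/
theorem contMDiffOn_spherePretriv_change [ContMDiffVectorBundle ∞ (Vec r) E (𝓡 m)]
    (e e' : Trivialization (Vec r) (π (Vec r) E)) [MemTrivializationAtlas e]
    [MemTrivializationAtlas e'] :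
    ContMDiffOn ((𝓡 m).prod (𝓡 r)) ((𝓡 m).prod (𝓡 r)) ∞
      (spherePretriv e' ∘ (spherePretriv e).toPartialEquiv.symm)
      ((e.baseSet ∩ e'.baseSet) ×ˢ Set.univ) := by
  have : Fact (finrank ℝ (Vec r) = r + 1) := ⟨finrank_euclideanSpace_fin⟩
  have h0 : ContMDiff ((𝓡 m).prod (𝓡 r)) 𝓘(ℝ, Vec r) ∞
      (fun q : M × Sph r ↦ (q.2 : Vec r)) :=
    (contMDiff_coe_sphere (n := r) (E := Vec r)).comp contMDiff_snd
  have h1 : ContMDiffOn ((𝓡 m).prod (𝓡 r)) 𝓘(ℝ, Vec r) ∞ (fun q : M × Sph r ↦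
      (e.coordChangeL ℝ e' q.1 : Vec r →L[ℝ] Vec r) (q.2 : Vec r))
      ((e.baseSet ∩ e'.baseSet) ×ˢ Set.univ) :=
    ((contMDiffOn_coordChangeL (IB := 𝓡 m) (n := ∞) e e').comp contMDiffOn_fst
      (fun q hq ↦ hq.1)).clm_apply h0.contMDiffOn
  have h2 : ContMDiffOn ((𝓡 m).prod (𝓡 r)) ((𝓡 m).prod (𝓡 r)) ∞ (fun q : M × Sph r ↦
      (q.1, radial (e.coordChangeL ℝ e' q.1 (q.2 : Vec r))))
      ((e.baseSet ∩ e'.baseSet) ×ˢ Set.univ) := by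
    refine contMDiffOn_fst.prodMk fun q hq ↦ ?_
    exact ContMDiffAt.comp_contMDiffWithinAt (f := fun q : M × Sph r ↦
        e.coordChangeL ℝ e' q.1 (q.2 : Vec r)) q (contMDiffAt_radial (coordChange_ne_zero e e'
      (ne_zero_of_mem_unit_sphere q.2))) (h1 q hq)
  exact h2.congr fun q hq ↦ spherePretriv_change e e' hq.1.1 hq.1.2

instance isManifold_sphereBundle [IsManifold (𝓡 m) ∞ M]
    [ContMDiffVectorBundle ∞ (Vec r) E (𝓡 m)] :
    IsManifold ((𝓡 m).prod (𝓡 r)) ∞ (SphereBundle r E) := by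
  have hS : IsManifold (𝓡 r) ∞ (Sph r) := IsManifold.of_le (n := ω) le_top
  have hP : IsManifold ((𝓡 m).prod (𝓡 r)) ∞ (M × Sph r) := inferInstance
  refine isManifold_of_contDiffOn _ _ _ ?_
  rintro _ _ ⟨_, ⟨_, ⟨_, ⟨e, he, rfl⟩, rfl⟩, rfl⟩, c, hc, rfl⟩
    ⟨_, ⟨_, ⟨_, ⟨e', he', rfl⟩, rfl⟩, rfl⟩, c', hc', rfl⟩
  have hc1 := contMDiffOn_symm_of_mem_maximalAtlas (I := (𝓡 m).prod (𝓡 r)) (n := ∞)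
    (IsManifold.subset_maximalAtlas hc)
  have hc2 := contMDiffOn_of_mem_maximalAtlas (I := (𝓡 m).prod (𝓡 r)) (n := ∞)
    (IsManifold.subset_maximalAtlas hc')
  have h := hc2.comp' ((contMDiffOn_spherePretriv_change (m := m) e e').comp' hc1)
  have h3 := (contMDiffOn_iff.1 h).2 (0, 0) (0, 0)
  refine h3.mono ?_
  rintro ⟨a, b⟩ hq
  simp only [mfld_simps] at hq
  obtain ⟨⟨⟨q1, q2⟩, q3, q4⟩, -⟩ := hq
  exact ⟨by rw [extChartAt_target, chartAt_self_eq]; exact ⟨trivial, by simp⟩, ⟨⟨q1, ⟨q2.1, q3⟩, trivial⟩, q4⟩,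
    by rw [Set.mem_preimage, extChartAt_source, chartAt_self_eq]; trivial⟩

variable (m r E) in
/-- The projection `π : SE → M` as a smooth map. -/
def sphereProj :
    ContMDiffMap ((𝓡 m).prod (𝓡 r)) (𝓡 m) (SphereBundle r E) M ∞ where
  val := π (Sph r) (SphereFibre r E)
  property := by
    intro p
    rw [contMDiffAt_iff]
    refine ⟨(FiberBundle.continuous_proj (Sph r) (SphereFibre r E)).continuousAt, ?_⟩
    have key : Set.EqOn (extChartAt (𝓡 m) p.proj ∘ TotalSpace.proj ∘
        (extChartAt ((𝓡 m).prod (𝓡 r)) p).symm) Prod.fst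
        (extChartAt ((𝓡 m).prod (𝓡 r)) p).target := by
      rintro ⟨a, b⟩ hq
      have hq1 : ((a, b) : _ × _) ∈ (chartAt (ModelProd (EuclideanSpace ℝ (Fin m))
          (EuclideanSpace ℝ (Fin r))) p).target := by
        rw [extChartAt_target] at hq; exact hq.1
      have ha : a ∈ (chartAt (EuclideanSpace ℝ (Fin m)) p.proj).target := hq1.1.1
      exact (chartAt (EuclideanSpace ℝ (Fin m)) p.proj).right_inv ha
    exact (contDiff_fst.contDiffWithinAt (n := ∞) (𝕜 := ℝ)).congr_of_eventuallyEq
      (Filter.eventuallyEq_of_mem (extChartAt_target_mem_nhdsWithin p) key)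
      (key (mem_extChartAt_target p))


/-! ### The fibres `S_xE` as manifolds -/

variable (r E) in
/-- The homeomorphism of `S_xE` with the unit sphere given by the trivialisation of `E` at `x`. -/
def fibreHomeo (x : M) : SphereFibre r E x ≃ₜ Sph r where
  toFun p := radial (trivializationAt (Vec r) E x ⟨x, p.rep⟩).2
  invFun s := ((spherePretriv (trivializationAt (Vec r) E x)).toPartialEquiv.symm (x, s)).2
  left_inv p := by
    have h := (spherePretriv (trivializationAt (Vec r) E x)).left_inv
      (x := (⟨x, p⟩ : SphereBundle r E)) (mem_baseSet_trivializationAt (Vec r) E x)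
    exact eq_of_heq (TotalSpace.mk.inj h).2
  right_inv s := by
    have h := (spherePretriv (trivializationAt (Vec r) E x)).right_inv
      (x := (x, s)) ⟨mem_baseSet_trivializationAt (Vec r) E x, trivial⟩
    exact congrArg Prod.snd h
  continuous_toFun := continuous_induced_dom
  continuous_invFun := by
    refine continuous_induced_rng.2 ?_
    refine continuous_id.congr fun s ↦ ?_
    have h := (spherePretriv (trivializationAt (Vec r) E x)).right_inv
      (x := (x, s)) ⟨mem_baseSet_trivializationAt (Vec r) E x, trivial⟩
    exact (congrArg Prod.snd h).symm

instance (x : M) : ChartedSpace (EuclideanSpace ℝ (Fin r)) (SphereFibre r E x) where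
  atlas := {f | ∃ c ∈ atlas (EuclideanSpace ℝ (Fin r)) (Sph r),
    f = (fibreHomeo r E x).toOpenPartialHomeomorph ≫ₕ c}
  chartAt p := (fibreHomeo r E x).toOpenPartialHomeomorph ≫ₕ
    chartAt (EuclideanSpace ℝ (Fin r)) (fibreHomeo r E x p)
  mem_chart_source p := by simp
  chart_mem_atlas p := ⟨_, chart_mem_atlas _ _, rfl⟩

instance (x : M) : IsManifold (𝓡 r) ∞ (SphereFibre r E x) := by
  have hS : IsManifold (𝓡 r) ∞ (Sph r) := IsManifold.of_le (n := ω) le_top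
  refine @IsManifold.mk' _ _ _ _ _ _ _ _ _ _ _ _ ⟨?_⟩
  rintro _ _ ⟨c, hc, rfl⟩ ⟨c', hc', rfl⟩
  refine (contDiffGroupoid ∞ (𝓡 r)).mem_of_eqOnSource
    ((contDiffGroupoid ∞ (𝓡 r)).compatible hc hc') ⟨?_, fun y hy ↦ ?_⟩
  · ext y; simp
  · simp

end SphereBundle

section Finsler

variable (m r : ℕ) {M : Type*} [TopologicalSpace M] [ChartedSpace (EuclideanSpace ℝ (Fin m)) M]
  [IsManifold (𝓡 m) ∞ M]
  (E : M → Type*) [∀ x, AddCommGroup (E x)] [∀ x, Module ℝ (E x)]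
  [∀ x, TopologicalSpace (E x)] [∀ x, IsTopologicalAddGroup (E x)] [∀ x, ContinuousSMul ℝ (E x)]
  [TopologicalSpace (TotalSpace (Vec r) E)] [FiberBundle (Vec r) E] [VectorBundle ℝ (Vec r) E]
  [ContMDiffVectorBundle ∞ (Vec r) E (𝓡 m)]

/-- The pull-back bundle `π^*E` over `SE`. -/
abbrev PullbackBundle : SphereBundle r E → Type _ :=
  (sphereProj r E m : SphereBundle r E → M) *ᵖ E


instance (p : SphereBundle r E) : AddCommGroup (PullbackBundle m r E p) :=
  inferInstanceAs (AddCommGroup (E (sphereProj r E m p)))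

instance (p : SphereBundle r E) : IsTopologicalAddGroup (PullbackBundle m r E p) :=
  inferInstanceAs (IsTopologicalAddGroup (E (sphereProj r E m p)))

instance (p : SphereBundle r E) : ContinuousSMul ℝ (PullbackBundle m r E p) :=
  inferInstanceAs (ContinuousSMul ℝ (E (sphereProj r E m p)))

/-- The second derivative `½ ∂²F²(y)[v, w]` of `½F²` along the fibre of `E` at `x`. -/
def halfHessian (F : TotalSpace (Vec r) E → ℝ) {x : M} (y v w : E x) : ℝ :=
  1 / 2 * lineDeriv ℝ (fun z : E x ↦ lineDeriv ℝ (fun z' : E x ↦ F ⟨x, z'⟩ ^ 2) z w) y v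

/-- A Finsler metric on the vector bundle `E` of rank `r + 1`. -/
structure FinslerMetric where
  /-- The function `F` on the total space of `E`. -/
  toFun : TotalSpace (Vec r) E → ℝ
  nonneg : ∀ u, 0 ≤ toFun u
  smooth : ContMDiffOn ((𝓡 m).prod 𝓘(ℝ, Vec r)) 𝓘(ℝ, ℝ) ∞ toFun
    {u : TotalSpace (Vec r) E | u.2 ≠ 0}
  homogeneous : ∀ (x : M) (y : E x) (a : ℝ), 0 < a → toFun ⟨x, a • y⟩ = a * toFun ⟨x, y⟩
  pos_def : ∀ (x : M) (y v : E x), y ≠ 0 → v ≠ 0 → 0 < halfHessian r E toFun y v v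

variable {m r E}

namespace FinslerMetric

variable (F : FinslerMetric m r E)

/-- The tautological section: `ℓ_{[y]} = y / F(y)`. -/
def ell {x : M} (p : SphereFibre r E x) : E x := (F.toFun ⟨x, p.rep⟩)⁻¹ • p.rep

/-- The tautological section `ℓ` of `π^*E`. -/
def ellSection (p : SphereBundle r E) : PullbackBundle m r E p := F.ell p.2

/-- The metric `g_{ij}(x, [y]) = ½ ∂²F² / ∂y^i ∂y^j (x, y)` on the fibre of `π^*E` at `(x, [y])`.
By homogeneity it depends only on the ray `[y]`; it is evaluated at `y = ℓ`. -/
def g {x : M} (p : SphereFibre r E x) (v w : E x) : ℝ := halfHessian r E F.toFun (F.ell p) v w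

/-- The Cartan tensor `A_{ijk}(x, [y]) = (F / 4) ∂³F² / ∂y^i ∂y^j ∂y^k (x, y)`.
By homogeneity it depends only on the ray `[y]`; it is evaluated at `y = ℓ`. -/
def cartan {x : M} (p : SphereFibre r E x) (u v w : E x) : ℝ :=
  F.toFun ⟨x, F.ell p⟩ / 4 * lineDeriv ℝ (fun z₁ : E x ↦ lineDeriv ℝ (fun z₂ : E x ↦
    lineDeriv ℝ (fun z₃ : E x ↦ F.toFun ⟨x, z₃⟩ ^ 2) z₂ w) z₁ v) (F.ell p) u

end FinslerMetric

/-- The local frame `s_0, …, s_r` of `E` around `x₀`. -/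
def frame (x₀ : M) (i : Fin (r + 1)) (x : M) : E x :=
  (trivializationAt (Vec r) E x₀).symm x (EuclideanSpace.single i 1)

/-- The local frame `𝔰_i` of `π^*E` over `π⁻¹` of a neighbourhood of `x₀`. -/
def pullbackFrame (x₀ : M) (i : Fin (r + 1)) (q : SphereBundle r E) : PullbackBundle m r E q :=
  frame x₀ i q.1

/-- The components `(σ^0, …, σ^r)` of a section `σ = σ^i 𝔰_i` of `π^*E` around `x₀`. -/
def components (x₀ : M) (σ : ∀ q : SphereBundle r E, PullbackBundle m r E q)
    (q : SphereBundle r E) : Vec r :=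
  (trivializationAt (Vec r) E x₀ ⟨q.1, σ q⟩).2

variable (m r E) in
/-- An Ehresmann connection on `SE → M`, given by the projection `Θ_p` of `T_p(SE)` onto the
vertical space `V_p(SE) = ker dπ_p`; the horizontal space is `H_p(SE) = ker Θ_p`, so that
`T(SE) = H(SE) ⊕ V(SE)`. -/
structure EhresmannConnection where
  /-- The vertical projection. -/
  vert : ∀ p : SphereBundle r E, TangentSpace ((𝓡 m).prod (𝓡 r)) p →L[ℝ]
    TangentSpace ((𝓡 m).prod (𝓡 r)) p
  idem : ∀ p ξ, vert p (vert p ξ) = vert p ξ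
  range_eq : ∀ p, Set.range (vert p) =
    {ξ | mfderiv ((𝓡 m).prod (𝓡 r)) (𝓡 m) (sphereProj r E m) p ξ = 0}
  smooth : ContMDiff ((𝓡 m).prod (𝓡 r)) (((𝓡 m).prod (𝓡 r)).prod
      𝓘(ℝ, (EuclideanSpace ℝ (Fin m) × EuclideanSpace ℝ (Fin r)) →L[ℝ]
        (EuclideanSpace ℝ (Fin m) × EuclideanSpace ℝ (Fin r)))) ∞
    (fun p ↦ TotalSpace.mk' ((EuclideanSpace ℝ (Fin m) × EuclideanSpace ℝ (Fin r)) →L[ℝ]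
        (EuclideanSpace ℝ (Fin m) × EuclideanSpace ℝ (Fin r)))
      (E := fun p : SphereBundle r E ↦ TangentSpace ((𝓡 m).prod (𝓡 r)) p →L[ℝ]
        TangentSpace ((𝓡 m).prod (𝓡 r)) p) p (vert p))

/-- The horizontal projection of `T_p(SE)`. -/
def EhresmannConnection.hor (N : EhresmannConnection m r E) (p : SphereBundle r E) :
    TangentSpace ((𝓡 m).prod (𝓡 r)) p →L[ℝ] TangentSpace ((𝓡 m).prod (𝓡 r)) p :=
  ContinuousLinearMap.id ℝ _ - N.vert p

variable (m r E) in
/-- Connections (covariant derivatives) on `π^*E`. -/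
abbrev Connection : Type _ :=
  CovariantDerivative ((𝓡 m).prod (𝓡 r)) (Vec r) (PullbackBundle m r E)

variable (F : FinslerMetric m r E) (N : EhresmannConnection m r E) (D : Connection m r E)

/-- `D` is compatible with `g`: `d g(σ, τ) = g(Dσ, τ) + g(σ, Dτ)`. -/
def IsMetricCompatible : Prop :=
  ∀ (σ τ : ∀ q : SphereBundle r E, PullbackBundle m r E q) (p : SphereBundle r E),
    MDifferentiableAt ((𝓡 m).prod (𝓡 r)) (((𝓡 m).prod (𝓡 r)).prod 𝓘(ℝ, Vec r))
      (fun q ↦ TotalSpace.mk' (Vec r) q (σ q)) p →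
    MDifferentiableAt ((𝓡 m).prod (𝓡 r)) (((𝓡 m).prod (𝓡 r)).prod 𝓘(ℝ, Vec r))
      (fun q ↦ TotalSpace.mk' (Vec r) q (τ q)) p →
    ∀ ξ : TangentSpace ((𝓡 m).prod (𝓡 r)) p,
      mvfderiv ((𝓡 m).prod (𝓡 r)) (fun q : SphereBundle r E ↦ F.g q.2 (σ q) (τ q)) p ξ =
        F.g p.2 (D σ p ξ) (τ p) + F.g p.2 (σ p) (D τ p ξ)

/-- The form `δy^k` at `p`, the `k`-th component of the derivative of `ℓ` along the vertical part
of a tangent vector. In homogeneous coordinates it is `(dy^k + N^k_A dx^A) / F` up to a multiple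
of the component `ℓ^k`; such a multiple is annihilated by the Cartan tensor. -/
def deltaY (p : SphereBundle r E) (k : Fin (r + 1)) :
    TangentSpace ((𝓡 m).prod (𝓡 r)) p →L[ℝ] ℝ :=
  mvfderiv ((𝓡 m).prod (𝓡 r))
    (fun q : SphereBundle r E ↦ components (m := m) p.1 F.ellSection q k) p ∘L N.vert p

/-- `A^j_{ik} = g^{jl} A_{lik}` at `p`, in the frame `𝔰_i`. -/
def cartanUp (p : SphereBundle r E) (j i k : Fin (r + 1)) : ℝ :=
  ∑ l, (Matrix.of fun a b ↦ F.g p.2 (frame (r := r) p.1 a p.1) (frame (r := r) p.1 b p.1))⁻¹ j l *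
    F.cartan p.2 (frame (r := r) p.1 l p.1) (frame (r := r) p.1 i p.1)
      (frame (r := r) p.1 k p.1)

/-- The value at `p` of `∇ 𝔰_i = (γ^j_{iA} dx^A + c A^j_{ik} δy^k) ⊗ 𝔰_j`, where
`γ^j_{iA} dx^A` is the horizontal part of the connection form of `D`. -/
def modifiedFrame (c : ℝ) (p : SphereBundle r E) (i : Fin (r + 1)) :
    TangentSpace ((𝓡 m).prod (𝓡 r)) p →L[ℝ] PullbackBundle m r E p :=
  D (pullbackFrame p.1 i) p ∘L N.hor p +
    ∑ j, (∑ k, (c * cartanUp F p j i k) • deltaY F N p k).smulRight (pullbackFrame p.1 j p)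


section Leibniz

variable {σ τ : ∀ q : SphereBundle r E, PullbackBundle m r E q} {p : SphereBundle r E}

theorem components_add {x₀ : M} {q : SphereBundle r E}
    (hq : q.1 ∈ (trivializationAt (Vec r) E x₀).baseSet) :
    components x₀ (σ + τ) q = components x₀ σ q + components x₀ τ q :=
  ((trivializationAt (Vec r) E x₀).linear ℝ hq).map_add (σ q) (τ q)

theorem components_smul {x₀ : M} {q : SphereBundle r E} (f : SphereBundle r E → ℝ)
    (hq : q.1 ∈ (trivializationAt (Vec r) E x₀).baseSet) :
    components x₀ (f • σ) q = f q • components x₀ σ q :=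
  ((trivializationAt (Vec r) E x₀).linear ℝ hq).map_smul (f q) (σ q)

theorem eventually_mem_baseSet (p : SphereBundle r E) :
    ∀ᶠ q in 𝓝 p, q.1 ∈ (trivializationAt (Vec r) E p.1).baseSet :=
  (FiberBundle.continuous_proj (Sph r) (SphereFibre r E)).continuousAt.eventually_mem
    ((trivializationAt (Vec r) E p.1).open_baseSet.mem_nhds
      (mem_baseSet_trivializationAt (Vec r) E p.1))

theorem mdifferentiableAt_components
    (hσ : MDifferentiableAt ((𝓡 m).prod (𝓡 r)) (((𝓡 m).prod (𝓡 r)).prod 𝓘(ℝ, Vec r))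
      (fun q ↦ TotalSpace.mk' (Vec r) q (σ q)) p) (i : Fin (r + 1)) :
    MDifferentiableAt ((𝓡 m).prod (𝓡 r)) 𝓘(ℝ, ℝ)
      (fun q : SphereBundle r E ↦ components p.1 σ q i) p := by
  have h := (mdifferentiableAt_section _ _).1 hσ
  exact ((EuclideanSpace.proj i : Vec r →L[ℝ] ℝ).differentiableAt).comp_mdifferentiableAt h

theorem mvfderiv_congr_nhds {f h : SphereBundle r E → ℝ} (hfh : f =ᶠ[𝓝 p] h) :
    mvfderiv ((𝓡 m).prod (𝓡 r)) f p = mvfderiv ((𝓡 m).prod (𝓡 r)) h p := by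
  ext ξ
  change (mfderiv ((𝓡 m).prod (𝓡 r)) 𝓘(ℝ, ℝ) f p ξ : ℝ) =
    mfderiv ((𝓡 m).prod (𝓡 r)) 𝓘(ℝ, ℝ) h p ξ
  rw [hfh.mfderiv_eq]
  rfl

theorem sum_components_smul (p : SphereBundle r E)
    (σ : ∀ q : SphereBundle r E, PullbackBundle m r E q) :
    ∑ i, components p.1 σ p i • pullbackFrame (m := m) p.1 i p = σ p := by
  let e := trivializationAt (Vec r) E p.1
  have hx : p.1 ∈ e.baseSet := mem_baseSet_trivializationAt (Vec r) E p.1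
  let L := (e.continuousLinearEquivAt ℝ p.1 hx).symm
  have hL : ∀ v, L v = e.symm p.1 v := fun v ↦ rfl
  have h1 : ∑ i, components p.1 σ p i • EuclideanSpace.single i (1 : ℝ) =
      components p.1 σ p := by
    ext j
    simp [Finset.sum_apply, Pi.single_apply]
  have h2 : L (components p.1 σ p) = σ p := e.symm_apply_apply_mk hx (σ p)
  rw [← h1, map_sum] at h2
  simp only [map_smul] at h2
  exact h2

end Leibniz

/-- The modified connection `∇` of `D` with constant `c`: the connection on `π^*E` with
`∇ 𝔰_i = (γ^j_{iA} dx^A + c A^j_{ik} δy^k) ⊗ 𝔰_j`, extended by the Leibniz rule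
`∇ (σ^i 𝔰_i) = dσ^i ⊗ 𝔰_i + σ^i ∇ 𝔰_i`. -/
def modifiedConnection (c : ℝ) : Connection m r E where
  toFun σ p := ∑ i, ((mvfderiv ((𝓡 m).prod (𝓡 r))
      (fun q : SphereBundle r E ↦ components p.1 σ q i) p).smulRight (pullbackFrame p.1 i p) +
    components p.1 σ p i • modifiedFrame F N D c p i)
  isCovariantDerivativeOnUniv := by
    refine ⟨fun {σ τ p} hσ hτ _ ↦ ?_, fun {σ f p} hσ hf _ ↦ ?_⟩
    · rw [← Finset.sum_add_distrib]
      refine Finset.sum_congr rfl fun i _ ↦ ?_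
      have h1 : (fun q : SphereBundle r E ↦ components p.1 (σ + τ) q i) =ᶠ[𝓝 p]
          fun q ↦ components p.1 σ q i + components p.1 τ q i :=
        (eventually_mem_baseSet p).mono fun q hq ↦ by simp [components_add hq]
      rw [mvfderiv_congr_nhds h1, mvfderiv_fun_add (mdifferentiableAt_components hσ i)
        (mdifferentiableAt_components hτ i),
        components_add (mem_baseSet_trivializationAt (Vec r) E p.1)]
      ext ξ
      simp only [add_apply, ContinuousLinearMap.smulRight_apply,
        smul_apply, PiLp.add_apply]
      module
    · have h3 : (mvfderiv ((𝓡 m).prod (𝓡 r)) f p).smulRight (σ p) = ∑ i,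
          components p.1 σ p i •
            (mvfderiv ((𝓡 m).prod (𝓡 r)) f p).smulRight (pullbackFrame p.1 i p) := by
        ext ξ
        rw [sum_apply]
        simp only [ContinuousLinearMap.smulRight_apply, smul_apply]
        conv_lhs => rw [← sum_components_smul p σ, Finset.smul_sum]
        exact Finset.sum_congr rfl fun i _ ↦ smul_comm _ _ _
      rw [h3, Finset.smul_sum, ← Finset.sum_add_distrib]
      refine Finset.sum_congr rfl fun i _ ↦ ?_
      have h1 : (fun q : SphereBundle r E ↦ components p.1 (f • σ) q i) =ᶠ[𝓝 p]
          fun q ↦ f q * components p.1 σ q i :=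
        (eventually_mem_baseSet p).mono fun q hq ↦ by simp [components_smul f hq]
      rw [mvfderiv_congr_nhds h1, mvfderiv_fun_mul hf (mdifferentiableAt_components hσ i),
        components_smul f (mem_baseSet_trivializationAt (Vec r) E p.1)]
      ext ξ
      simp only [add_apply, ContinuousLinearMap.smulRight_apply,
        smul_apply, PiLp.smul_apply, smul_eq_mul]
      module

/-! ### Connection forms, and the volume form of `S_xE` -/

/-- The connection form `ϖ_i^j` at `p`, defined by `∇ e_i = ϖ_i^j ⊗ e_j`. -/
def connectionForm {e : Fin (r + 1) → ∀ q : SphereBundle r E, PullbackBundle m r E q}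
    {W : Set (SphereBundle r E)} (D : Connection m r E)
    (he : IsLocalFrameOn ((𝓡 m).prod (𝓡 r)) (Vec r) ∞ e W) (i j : Fin (r + 1))
    (p : SphereBundle r E) : TangentSpace ((𝓡 m).prod (𝓡 r)) p →ₗ[ℝ] ℝ :=
  he.coeff j p ∘ₗ (D (e i) p).toLinearMap

/-- The wedge product `η_0 ∧ … ∧ η_{k-1}` of linear forms,
`(η_0 ∧ … ∧ η_{k-1})(v_0, …, v_{k-1}) = det (η_i (v_j))`. -/
def wedge {k : ℕ} {V : Type*} [AddCommGroup V] [Module ℝ V] (η : Fin k → V →ₗ[ℝ] ℝ) :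
    V [⋀^Fin k]→ₗ[ℝ] ℝ :=
  Matrix.detRowAlternating.compLinearMap (LinearMap.pi η)

theorem wedge_apply {k : ℕ} {V : Type*} [AddCommGroup V] [Module ℝ V] (η : Fin k → V →ₗ[ℝ] ℝ)
    (v : Fin k → V) : wedge η v = Matrix.det (Matrix.of fun i j ↦ η i (v j)) := by
  rw [← Matrix.det_transpose]
  rfl

variable (r E) in
/-- The inclusion `i_x : S_xE → SE`. -/
def fibreInclusion (x : M) (p : SphereFibre r E x) : SphereBundle r E := ⟨x, p⟩

/-- The pull-back by `i_x` of a form on `T_{i_x(p)}(SE)` to a form on `T_p(S_xE)`. -/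
def fibrePullback {k : ℕ} {x : M} (p : SphereFibre r E x)
    (η : TangentSpace ((𝓡 m).prod (𝓡 r)) (fibreInclusion r E x p) [⋀^Fin k]→ₗ[ℝ] ℝ) :
    TangentSpace (𝓡 r) p [⋀^Fin k]→ₗ[ℝ] ℝ :=
  η.compLinearMap
    (mfderiv (𝓡 r) ((𝓡 m).prod (𝓡 r)) (fibreInclusion r E x) p).toLinearMap

/-- The derivative at `p` of the embedding `ℓ : S_xE → E_x` onto the indicatrix `{F = 1}`. -/
def dEll {x : M} (p : SphereFibre r E x) (v : TangentSpace (𝓡 r) p) : E x :=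
  (trivializationAt (Vec r) E x).symm x (mvfderiv (𝓡 r)
    (fun q : SphereFibre r E x ↦ (trivializationAt (Vec r) E x ⟨x, F.ell q⟩).2) p v)

/-- The Riemannian metric on `S_xE` induced by `F`: the restriction of `g` to the indicatrix. -/
def fibreMetric {x : M} (p : SphereFibre r E x) (v w : TangentSpace (𝓡 r) p) : ℝ :=
  F.g p (dEll F p v) (dEll F p w)

/-- The sign (`1`, `-1`, or `0` for dependent vectors) of a tuple of vectors of `V` with respect to
an orientation of `V`. -/
def orientationSign {k : ℕ} {V : Type*} [AddCommGroup V] [Module ℝ V]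
    (o : Orientation ℝ V (Fin k)) (u : Fin k → V) : ℝ :=
  Real.sign ((Module.Ray.someVector o) u)

/-- The Riemannian volume form of `S_xE`, with the metric induced by `F` and the orientation induced
by an orientation `o` of `E_x` (outward normal first; the outward normal at `p` is `ℓ_p`): its value
on `v` is `± √ det (g(v_i, v_j))`, with the sign of `v`. -/
def fibreVolume {x : M} (o : Orientation ℝ (E x) (Fin (r + 1))) (p : SphereFibre r E x)
    (v : Fin r → TangentSpace (𝓡 r) p) : ℝ :=
  orientationSign o (Fin.cons (F.ell p) fun i ↦ dEll F p (v i)) *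
    √(Matrix.det (Matrix.of fun i j ↦ fibreMetric F p (v i) (v j)))

end Finsler
end FinslerGBC

end

/-! On vectors tangent to a fibre, the form $\varpi_i^n$ does not see the connection. Such vectors
are vertical, so the horizontal part coming from $D$ vanishes on them. The remaining term
$c\,A^j_{ik}\delta y^k$ has $\ell$-component $c\,A(\ell,\mathfrak s_i,\mathfrak s_k)\,\delta y^k$,
which is zero because $D^2(F^2)$ is homogeneous of degree $0$ (`sum_cartan_eq_zero`,
`g_modifiedFrame_ell`). Hence $\varpi_i^n(v)=g(de_i(v),\ell)$, where $de_i$ is the ordinary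
derivative in the fixed vector space $\mathscr E_x$ (`g_modifiedConnection_ell`).

By Euler's relation $g(\ell,u)=\frac12 d(F^2)_\ell(u)$. Differentiating $g(\ell,e_i)=0$ along the
fibre gives $g(d\ell(v),e_i)+g(\ell,de_i(v))=0$, since the derivative of $\frac12 d(F^2)$ is $g$
itself (`g_dEll_add_g_ell_mvfderiv`). So $\varpi_i^n(v)=-g(d\ell(v),e_i)$ for $i<n$
(`connectionForm_last_fibreInclusion`).

The rest is linear algebra (`orientationSign_mul_sqrt_gram`). Let $C$ be the matrix of the vectors
$d\ell(v_j)\perp\ell$ in the basis $e_1,\dots,e_{n-1}$. The wedge product is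
$\det(-C)=(-1)^{n-1}\det C$. The Gram determinant is $(\det C)^2$, and moving the outward normal
$\ell=e_n$ from first to last place costs the same sign $(-1)^{n-1}$. The two signs agree, which is
why the formula holds exactly under the "outward normal first" rule. -/

noncomputable section
namespace FinslerGBC

/-! ### Euler's relation and iterated directional derivatives of homogeneous functions -/

section Homogeneous

variable {V G : Type*} [NormedAddCommGroup V] [NormedSpace ℝ V]
  [NormedAddCommGroup G] [NormedSpace ℝ G]

/-- Euler's relation for positively homogeneous functions. -/
theorem fderiv_self_of_homogeneous {ψ : V → G} {k : ℕ} {y : V}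
    (hψ : ∀ a : ℝ, 0 < a → ψ (a • y) = a ^ k • ψ y) (hd : DifferentiableAt ℝ ψ y) :
    fderiv ℝ ψ y y = (k : ℝ) • ψ y := by
  have hd' : HasFDerivAt ψ (fderiv ℝ ψ y) ((1 : ℝ) • y) := by
    rw [one_smul]; exact hd.hasFDerivAt
  have h1 : HasDerivAt (fun a : ℝ ↦ ψ (a • y)) (fderiv ℝ ψ y ((1 : ℝ) • y)) 1 :=
    hd'.comp_hasDerivAt (1 : ℝ) ((hasDerivAt_id (1 : ℝ)).smul_const y)
  have h2 : HasDerivAt (fun a : ℝ ↦ a ^ k • ψ y) ((k * (1 : ℝ) ^ (k - 1)) • ψ y) 1 :=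
    (hasDerivAt_pow k (1 : ℝ)).smul_const (ψ y)
  -- Homogeneity is available only for positive factors, which suffices near $a=1$.
  have h3 : (fun a : ℝ ↦ ψ (a • y)) =ᶠ[𝓝 1] fun a ↦ a ^ k • ψ y :=
    (eventually_gt_nhds one_pos).mono fun a ha ↦ hψ a ha
  simpa using h1.unique (h2.congr_of_eventuallyEq h3)

/-- The derivative of a positively homogeneous function of degree `k + 1` is positively
homogeneous of degree `k`. -/
theorem fderiv_homogeneous {ψ : V → G} {k : ℕ}
    (hψ : ∀ (y : V) (a : ℝ), 0 < a → ψ (a • y) = a ^ (k + 1) • ψ y) (y : V) (a : ℝ)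
    (ha : 0 < a) : fderiv ℝ ψ (a • y) = a ^ k • fderiv ℝ ψ y := by
  -- Both sides of $\psi(az)=a^{k+1}\psi(z)$ are differentiated in $z$ and one factor $a$ is
  -- cancelled. Neither rule needs differentiability of $\psi$.
  have h1 : fderiv ℝ (fun z ↦ ψ (a • z)) y = a • fderiv ℝ ψ (a • y) := fderiv_comp_smul ..
  have h2 : (fun z ↦ ψ (a • z)) = a ^ (k + 1) • ψ := funext fun z ↦ hψ z a ha
  rw [h2, fderiv_const_smul_field, pow_succ', mul_smul] at h1
  exact (smul_right_injective _ ha.ne' h1).symm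

/-- A line derivative uses only the linear structure of the domain. This lets $g$ and $A$, defined
on fibres that carry no norm, be moved to the model space where Fréchet calculus applies. -/
theorem lineDeriv_comp_linearEquiv {W : Type*} [AddCommGroup W] [Module ℝ W] (L : W ≃ₗ[ℝ] V)
    (f : W → G) (y v : W) :
    lineDeriv ℝ f y v = lineDeriv ℝ (fun z ↦ f (L.symm z)) (L y) (L v) := by
  simp [lineDeriv]

theorem contDiffAt_fderiv_of_ne_zero {φ : V → G} (hφ : ∀ y ≠ 0, ContDiffAt ℝ ∞ φ y) :
    ∀ y ≠ 0, ContDiffAt ℝ ∞ (fderiv ℝ φ) y :=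
  fun y hy ↦ (hφ y hy).fderiv_right (by simp)

/-- Smoothness fails at the origin, so the inner derivatives are identified only as germs at
$y\ne0$, which is all that the outer derivative sees. -/
theorem lineDeriv_lineDeriv_eq {φ : V → ℝ} (hφ : ∀ y ≠ 0, ContDiffAt ℝ ∞ φ y) {y : V}
    (hy : y ≠ 0) (v w : V) :
    lineDeriv ℝ (fun z ↦ lineDeriv ℝ φ z w) y v = fderiv ℝ (fderiv ℝ φ) y v w := by
  have h1 : (fun z ↦ lineDeriv ℝ φ z w) =ᶠ[𝓝 y] fun z ↦ fderiv ℝ φ z w :=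
    (eventually_ne_nhds hy).mono fun z hz ↦
      ((hφ z hz).differentiableAt (by simp)).lineDeriv_eq_fderiv
  have h2 : DifferentiableAt ℝ (fderiv ℝ φ) y :=
    (contDiffAt_fderiv_of_ne_zero hφ y hy).differentiableAt (by simp)
  have h3 : HasFDerivAt (fun z ↦ fderiv ℝ φ z w) ((fderiv ℝ (fderiv ℝ φ) y).flip w) y := by
    simpa using h2.hasFDerivAt.clm_apply (hasFDerivAt_const w y)
  rw [Filter.EventuallyEq.lineDeriv_eq h1, h3.differentiableAt.lineDeriv_eq_fderiv, h3.fderiv]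
  rfl

theorem lineDeriv_lineDeriv_lineDeriv_eq {φ : V → ℝ} (hφ : ∀ y ≠ 0, ContDiffAt ℝ ∞ φ y) {y : V}
    (hy : y ≠ 0) (u v w : V) :
    lineDeriv ℝ (fun z ↦ lineDeriv ℝ (fun z' ↦ lineDeriv ℝ φ z' w) z v) y u =
      fderiv ℝ (fderiv ℝ (fderiv ℝ φ)) y u v w := by
  have h1 : (fun z ↦ lineDeriv ℝ (fun z' ↦ lineDeriv ℝ φ z' w) z v) =ᶠ[𝓝 y]
      fun z ↦ fderiv ℝ (fderiv ℝ φ) z v w :=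
    (eventually_ne_nhds hy).mono fun z hz ↦ lineDeriv_lineDeriv_eq hφ hz v w
  have h2 : DifferentiableAt ℝ (fderiv ℝ (fderiv ℝ φ)) y :=
    (contDiffAt_fderiv_of_ne_zero (contDiffAt_fderiv_of_ne_zero hφ) y hy).differentiableAt
      (by simp)
  have h3 : HasFDerivAt (fun z ↦ fderiv ℝ (fderiv ℝ φ) z v w)
      (((fderiv ℝ (fderiv ℝ (fderiv ℝ φ)) y).flip v).flip w) y := by
    have h4 : HasFDerivAt (fun z ↦ fderiv ℝ (fderiv ℝ φ) z v)
        ((fderiv ℝ (fderiv ℝ (fderiv ℝ φ)) y).flip v) y := by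
      simpa using h2.hasFDerivAt.clm_apply (hasFDerivAt_const v y)
    simpa using h4.clm_apply (hasFDerivAt_const w y)
  rw [Filter.EventuallyEq.lineDeriv_eq h1, h3.differentiableAt.lineDeriv_eq_fderiv, h3.fderiv]
  rfl

end Homogeneous

/-! ### The metric and the Cartan tensor as Fréchet derivatives of $F^2$ on a fibre -/

section FibreCalculus

variable {m r : ℕ} {M : Type*} [TopologicalSpace M] [ChartedSpace (EuclideanSpace ℝ (Fin m)) M]
  [IsManifold (𝓡 m) ∞ M]
  {E : M → Type*} [∀ x, AddCommGroup (E x)] [∀ x, Module ℝ (E x)]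
  [∀ x, TopologicalSpace (E x)] [∀ x, IsTopologicalAddGroup (E x)] [∀ x, ContinuousSMul ℝ (E x)]
  [TopologicalSpace (TotalSpace (Vec r) E)] [FiberBundle (Vec r) E] [VectorBundle ℝ (Vec r) E]
  [ContMDiffVectorBundle ∞ (Vec r) E (𝓡 m)]

variable (r E) in
/-- The linear isomorphism of the fibre `E x` with the model fibre given by the preferred
trivialisation at `x`. -/
def fibreEquiv (x : M) : E x ≃L[ℝ] Vec r :=
  (trivializationAt (Vec r) E x).continuousLinearEquivAt ℝ x (mem_baseSet_trivializationAt _ E x)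

theorem fibreEquiv_apply (x : M) (y : E x) :
    fibreEquiv r E x y = (trivializationAt (Vec r) E x ⟨x, y⟩).2 := by
  simp [fibreEquiv]

theorem fibreEquiv_symm_apply (x : M) (z : Vec r) :
    (fibreEquiv r E x).symm z = (trivializationAt (Vec r) E x).symm x z := rfl

theorem contMDiff_fibreEquiv_symm (x : M) :
    ContMDiff 𝓘(ℝ, Vec r) ((𝓡 m).prod 𝓘(ℝ, Vec r)) ∞
      (fun z : Vec r ↦ (⟨x, (fibreEquiv r E x).symm z⟩ : TotalSpace (Vec r) E)) := by
  intro z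
  rw [Bundle.contMDiffAt_totalSpace]
  refine ⟨contMDiffAt_const, ?_⟩
  have h : (fun z : Vec r ↦ (trivializationAt (Vec r) E x
      (⟨x, (fibreEquiv r E x).symm z⟩ : TotalSpace (Vec r) E)).2) = id := by
    funext z
    rw [← fibreEquiv_apply]; simp
  exact h ▸ contMDiffAt_id

namespace FinslerMetric

variable (F : FinslerMetric m r E)

/-- The restriction of `F` to the fibre at `x`, as a function on the model fibre. -/
def onFibre (x : M) (z : Vec r) : ℝ := F.toFun ⟨x, (fibreEquiv r E x).symm z⟩

/-- The restriction of `F²` to the fibre at `x`, as a function on the model fibre. -/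
def sqOnFibre (x : M) (z : Vec r) : ℝ := F.onFibre x z ^ 2

theorem sqOnFibre_eq (x : M) :
    F.sqOnFibre x = fun z ↦ F.toFun ⟨x, (fibreEquiv r E x).symm z⟩ ^ 2 := rfl

theorem contDiffAt_onFibre (x : M) {z : Vec r} (hz : z ≠ 0) : ContDiffAt ℝ ∞ (F.onFibre x) z := by
  have h1 := F.smooth.comp (s := {0}ᶜ) (contMDiff_fibreEquiv_symm (m := m) (E := E) x).contMDiffOn
    fun y hy ↦ by simpa using hy
  exact (h1.contMDiffAt (isOpen_compl_singleton.mem_nhds hz)).contDiffAt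

theorem contDiffAt_sqOnFibre (x : M) : ∀ z ≠ 0, ContDiffAt ℝ ∞ (F.sqOnFibre x) z :=
  fun _ hz ↦ (F.contDiffAt_onFibre x hz).pow 2

theorem onFibre_smul (x : M) (z : Vec r) (a : ℝ) (ha : 0 < a) :
    F.onFibre x (a • z) = a * F.onFibre x z := by
  simp [onFibre, F.homogeneous x _ a ha]

theorem sqOnFibre_smul (x : M) (z : Vec r) (a : ℝ) (ha : 0 < a) :
    F.sqOnFibre x (a • z) = a ^ (1 + 1) • F.sqOnFibre x z := by
  simp [sqOnFibre, F.onFibre_smul x z a ha, mul_pow]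

theorem halfHessian_eq {x : M} {y : E x} (hy : y ≠ 0) (v w : E x) :
    halfHessian r E F.toFun y v w = 1 / 2 * fderiv ℝ (fderiv ℝ (F.sqOnFibre x))
      (fibreEquiv r E x y) (fibreEquiv r E x v) (fibreEquiv r E x w) := by
  have hy' : fibreEquiv r E x y ≠ 0 := by simpa using hy
  rw [halfHessian, ← lineDeriv_lineDeriv_eq (F.contDiffAt_sqOnFibre x) hy']
  congr 1
  rw [lineDeriv_comp_linearEquiv (fibreEquiv r E x).toLinearEquiv]
  congr 1
  funext z
  rw [lineDeriv_comp_linearEquiv (fibreEquiv r E x).toLinearEquiv]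
  simp [sqOnFibre_eq]

theorem fderiv_sqOnFibre_self {x : M} {z : Vec r} (hz : z ≠ 0) :
    fderiv ℝ (F.sqOnFibre x) z z = 2 * F.sqOnFibre x z := by
  simpa using fderiv_self_of_homogeneous (fun a ha ↦ F.sqOnFibre_smul x z a ha)
    ((F.contDiffAt_sqOnFibre x z hz).differentiableAt (by simp))

theorem fderiv_fderiv_sqOnFibre_self {x : M} {z : Vec r} (hz : z ≠ 0) :
    fderiv ℝ (fderiv ℝ (F.sqOnFibre x)) z z = fderiv ℝ (F.sqOnFibre x) z := by
  simpa using fderiv_self_of_homogeneous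
    (fun a ha ↦ fderiv_homogeneous (k := 1) (F.sqOnFibre_smul x) z a ha)
    ((contDiffAt_fderiv_of_ne_zero (F.contDiffAt_sqOnFibre x) z hz).differentiableAt (by simp))

/-- $F^2$ has degree $2$, so its second derivative has degree $0$ and Euler's relation gives zero.
This is the source of $A(\ell,\cdot,\cdot)=0$. -/
theorem fderiv_fderiv_fderiv_sqOnFibre_self {x : M} {z : Vec r} (hz : z ≠ 0) :
    fderiv ℝ (fderiv ℝ (fderiv ℝ (F.sqOnFibre x))) z z = 0 := by
  simpa using fderiv_self_of_homogeneous
    (fun a ha ↦ fderiv_homogeneous (k := 0) (fun z a ha ↦ by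
      simpa using fderiv_homogeneous (k := 1) (F.sqOnFibre_smul x) z a ha) z a ha)
    ((contDiffAt_fderiv_of_ne_zero (contDiffAt_fderiv_of_ne_zero
      (F.contDiffAt_sqOnFibre x)) z hz).differentiableAt (by simp))

theorem fderiv_fderiv_sqOnFibre_comm {x : M} {z : Vec r} (hz : z ≠ 0) (v w : Vec r) :
    fderiv ℝ (fderiv ℝ (F.sqOnFibre x)) z v w = fderiv ℝ (fderiv ℝ (F.sqOnFibre x)) z w v :=
  ((F.contDiffAt_sqOnFibre x z hz).isSymmSndFDerivAt
    (by rw [minSmoothness_of_isRCLikeNormedField]; exact ENat.LEInfty.out)) v w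

/-- Two applications of Euler's relation give $g_y(y,y)=F(y)^2$, so positive definiteness excludes
$F(y)=0$. -/
theorem pos {x : M} {y : E x} (hy : y ≠ 0) : 0 < F.toFun ⟨x, y⟩ := by
  have hy' : fibreEquiv r E x y ≠ 0 := by simpa using hy
  have h := F.pos_def x y y hy hy
  rw [F.halfHessian_eq hy, F.fderiv_fderiv_sqOnFibre_self hy', F.fderiv_sqOnFibre_self hy'] at h
  have h2 : F.sqOnFibre x (fibreEquiv r E x y) = F.toFun ⟨x, y⟩ ^ 2 := by
    simp [sqOnFibre, onFibre]
  refine (F.nonneg _).lt_of_ne' fun h0 ↦ ?_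
  simp [h2, h0] at h

theorem ell_ne_zero {x : M} (p : SphereFibre r E x) : F.ell p ≠ 0 :=
  smul_ne_zero (inv_ne_zero (F.pos p.rep_ne_zero).ne') p.rep_ne_zero

theorem toFun_ell {x : M} (p : SphereFibre r E x) : F.toFun ⟨x, F.ell p⟩ = 1 := by
  have h := F.pos p.rep_ne_zero
  rw [ell, F.homogeneous _ _ _ (inv_pos.2 h), inv_mul_cancel₀ h.ne']

theorem g_eq {x : M} (p : SphereFibre r E x) (v w : E x) :
    F.g p v w = 1 / 2 * fderiv ℝ (fderiv ℝ (F.sqOnFibre x))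
      (fibreEquiv r E x (F.ell p)) (fibreEquiv r E x v) (fibreEquiv r E x w) :=
  F.halfHessian_eq (F.ell_ne_zero p) v w

/-- The metric `g` at a point of `SE`, as a bilinear form. -/
def gForm {x : M} (p : SphereFibre r E x) : LinearMap.BilinForm ℝ (E x) :=
  LinearMap.mk₂ ℝ (F.g p) (by simp [g_eq, mul_add]) (by simp [g_eq]; intros; ring)
    (by simp [g_eq, mul_add]) (by simp [g_eq]; intros; ring)

theorem gForm_apply {x : M} (p : SphereFibre r E x) (v w : E x) :
    F.gForm p v w = F.g p v w := rfl

theorem g_comm {x : M} (p : SphereFibre r E x) (v w : E x) : F.g p v w = F.g p w v := by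
  have h : fibreEquiv r E x (F.ell p) ≠ 0 := by simpa using F.ell_ne_zero p
  rw [g_eq, g_eq, F.fderiv_fderiv_sqOnFibre_comm h]

/-- Euler's relation lowers the order of differentiation by one. Orthogonality to $\ell$ thus
becomes a condition on $d(F^2)$, and differentiating it brings in only the Hessian. -/
theorem g_ell_left {x : M} (p : SphereFibre r E x) (v : E x) :
    F.g p (F.ell p) v =
      1 / 2 * fderiv ℝ (F.sqOnFibre x) (fibreEquiv r E x (F.ell p)) (fibreEquiv r E x v) := by
  have h : fibreEquiv r E x (F.ell p) ≠ 0 := by simpa using F.ell_ne_zero p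
  rw [g_eq, F.fderiv_fderiv_sqOnFibre_self h]

theorem cartan_eq {x : M} (p : SphereFibre r E x) (u v w : E x) :
    F.cartan p u v w = 1 / 4 * fderiv ℝ (fderiv ℝ (fderiv ℝ (F.sqOnFibre x)))
      (fibreEquiv r E x (F.ell p)) (fibreEquiv r E x u) (fibreEquiv r E x v)
      (fibreEquiv r E x w) := by
  have hy' : fibreEquiv r E x (F.ell p) ≠ 0 := by simpa using F.ell_ne_zero p
  rw [cartan, toFun_ell, ← lineDeriv_lineDeriv_lineDeriv_eq (F.contDiffAt_sqOnFibre x) hy']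
  congr 1
  rw [lineDeriv_comp_linearEquiv (fibreEquiv r E x).toLinearEquiv]
  congr 1
  funext z
  rw [lineDeriv_comp_linearEquiv (fibreEquiv r E x).toLinearEquiv]
  congr 1
  · funext z'
    rw [lineDeriv_comp_linearEquiv (fibreEquiv r E x).toLinearEquiv]
    simp [sqOnFibre_eq]
  · simp

/-- The Cartan tensor annihilates the tautological section. -/
theorem sum_cartan_eq_zero {x : M} (p : SphereFibre r E x) {ι : Type*} [Fintype ι] (a : ι → ℝ)
    (s : ι → E x) (hs : ∑ l, a l • s l = F.ell p) (v w : E x) :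
    ∑ l, a l * F.cartan p (s l) v w = 0 := by
  have h : fibreEquiv r E x (F.ell p) ≠ 0 := by simpa using F.ell_ne_zero p
  have h1 := F.fderiv_fderiv_fderiv_sqOnFibre_self (x := x) h
  set T := fderiv ℝ (fderiv ℝ (fderiv ℝ (F.sqOnFibre x))) (fibreEquiv r E x (F.ell p))
  let Λ : E x →L[ℝ] ℝ := ((T.flip (fibreEquiv r E x v)).flip (fibreEquiv r E x w)).comp
    (fibreEquiv r E x : E x →L[ℝ] Vec r)
  have h2 : ∀ u, F.cartan p u v w = 1 / 4 * Λ u := fun u ↦ F.cartan_eq p u v w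
  have h3 : Λ (F.ell p) = 0 :=
    congrArg (fun S : Vec r →L[ℝ] Vec r →L[ℝ] ℝ ↦ S (fibreEquiv r E x v) (fibreEquiv r E x w)) h1
  simp only [← hs, map_sum Λ, map_smul Λ, smul_eq_mul] at h3
  rw [← mul_zero (1 / 4 : ℝ), ← h3, Finset.mul_sum]
  exact Finset.sum_congr rfl fun l _ ↦ by rw [h2]; ring

end FinslerMetric
end FibreCalculus

/-! ### Smoothness of the fibre inclusion and of $\ell$; verticality of fibre directions -/

section FibreMaps

variable {m r : ℕ} {M : Type*} [TopologicalSpace M] [ChartedSpace (EuclideanSpace ℝ (Fin m)) M]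
  [IsManifold (𝓡 m) ∞ M]
  {E : M → Type*} [∀ x, AddCommGroup (E x)] [∀ x, Module ℝ (E x)]
  [∀ x, TopologicalSpace (E x)] [∀ x, IsTopologicalAddGroup (E x)] [∀ x, ContinuousSMul ℝ (E x)]
  [TopologicalSpace (TotalSpace (Vec r) E)] [FiberBundle (Vec r) E] [VectorBundle ℝ (Vec r) E]
  [ContMDiffVectorBundle ∞ (Vec r) E (𝓡 m)]

/-- The charts of the fibre are sphere charts composed with this homeomorphism, so its coordinate
expression is the identity. -/
theorem contMDiff_fibreHomeo (x : M) : ContMDiff (𝓡 r) (𝓡 r) ∞ (fibreHomeo r E x) := by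
  intro p
  rw [contMDiffAt_iff]
  refine ⟨(fibreHomeo r E x).continuous.continuousAt, ?_⟩
  have key : Set.EqOn (extChartAt (𝓡 r) (fibreHomeo r E x p) ∘ fibreHomeo r E x ∘
      (extChartAt (𝓡 r) p).symm) id (extChartAt (𝓡 r) p).target := by
    intro a ha
    exact (extChartAt (𝓡 r) p).right_inv ha
  exact contDiff_id.contDiffWithinAt.congr_of_eventuallyEq
    (Filter.eventuallyEq_of_mem (extChartAt_target_mem_nhdsWithin p) key)
    (key (mem_extChartAt_target p))

/-- Fibre and total space use the same trivialisation at $x$, so the coordinate expression is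
$a\mapsto(\mathrm{const},a)$. -/
theorem contMDiff_fibreInclusion (x : M) :
    ContMDiff (𝓡 r) ((𝓡 m).prod (𝓡 r)) ∞ (fibreInclusion r E x) := by
  intro p
  rw [contMDiffAt_iff]
  refine ⟨(FiberBundle.continuous_totalSpaceMk (Sph r) (SphereFibre r E) x).continuousAt, ?_⟩
  have key : Set.EqOn (extChartAt ((𝓡 m).prod (𝓡 r)) (fibreInclusion r E x p) ∘
      fibreInclusion r E x ∘ (extChartAt (𝓡 r) p).symm)
      (fun a ↦ (extChartAt (𝓡 m) x x, a)) (extChartAt (𝓡 r) p).target := by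
    intro a ha
    exact Prod.ext rfl ((extChartAt (𝓡 r) p).right_inv ha)
  exact (contDiff_const.prodMk contDiff_id).contDiffWithinAt.congr_of_eventuallyEq
    (Filter.eventuallyEq_of_mem (extChartAt_target_mem_nhdsWithin p) key)
    (key (mem_extChartAt_target p))

/-- Vectors tangent to a fibre of `SE` are vertical. -/
theorem mfderiv_sphereProj_fibreInclusion {x : M} (p : SphereFibre r E x)
    (v : TangentSpace (𝓡 r) p) :
    mfderiv ((𝓡 m).prod (𝓡 r)) (𝓡 m) (sphereProj r E m) (fibreInclusion r E x p)
      (mfderiv (𝓡 r) ((𝓡 m).prod (𝓡 r)) (fibreInclusion r E x) p v) = 0 := by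
  have h1 : MDifferentiableAt ((𝓡 m).prod (𝓡 r)) (𝓡 m) (sphereProj r E m)
      (fibreInclusion r E x p) :=
    ((sphereProj r E m).contMDiff _).mdifferentiableAt (by simp)
  have h2 := (contMDiff_fibreInclusion (m := m) x p).mdifferentiableAt (by simp)
  have h3 := mfderiv_comp p h1 h2
  have h4 : (sphereProj r E m : SphereBundle r E → M) ∘ fibreInclusion r E x = fun _ ↦ x := rfl
  rw [h4, mfderiv_const] at h3
  exact (DFunLike.congr_fun h3 v).symm

/-- Being in $\ker d\pi$, the vector lies in the range of the idempotent vertical projection, which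
therefore fixes it. -/
theorem EhresmannConnection.hor_fibreInclusion (N : EhresmannConnection m r E) {x : M}
    (p : SphereFibre r E x) (v : TangentSpace (𝓡 r) p) :
    N.hor (fibreInclusion r E x p)
      (mfderiv (𝓡 r) ((𝓡 m).prod (𝓡 r)) (fibreInclusion r E x) p v) = 0 := by
  obtain ⟨ξ, hξ⟩ := (N.range_eq (fibreInclusion r E x p)).ge
    (mfderiv_sphereProj_fibreInclusion (m := m) p v)
  rw [← hξ]
  simp [EhresmannConnection.hor, N.idem]

namespace FinslerMetric

variable (F : FinslerMetric m r E)

/-- The chosen representative of the ray need not vary continuously. Rewriting $\ell$ as $s/F(s)$,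
with $s$ the corresponding point of the unit sphere, removes that choice and makes smoothness
visible. -/
theorem fibreEquiv_ell {x : M} (p : SphereFibre r E x) :
    fibreEquiv r E x (F.ell p) =
      (F.onFibre x (fibreHomeo r E x p))⁻¹ • (fibreHomeo r E x p : Vec r) := by
  have h0 : fibreEquiv r E x p.rep ≠ 0 := by simpa using p.rep_ne_zero
  have h1 : (fibreHomeo r E x p : Vec r) =
      ‖fibreEquiv r E x p.rep‖⁻¹ • fibreEquiv r E x p.rep := by
    rw [fibreEquiv_apply, ← radial_coe (by rwa [← fibreEquiv_apply])]; rfl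
  have h2 := norm_pos_iff.2 h0
  rw [h1, F.onFibre_smul _ _ _ (inv_pos.2 h2), ell, map_smul, onFibre,
    ContinuousLinearEquiv.symm_apply_apply, smul_smul]
  congr 1
  field_simp

theorem contMDiff_fibreEquiv_ell (x : M) :
    ContMDiff (𝓡 r) 𝓘(ℝ, Vec r) ∞ fun q : SphereFibre r E x ↦ fibreEquiv r E x (F.ell q) := by
  have : Fact (finrank ℝ (Vec r) = r + 1) := ⟨finrank_euclideanSpace_fin⟩
  intro p
  simp only [fibreEquiv_ell]
  have hs := ne_zero_of_mem_unit_sphere (fibreHomeo r E x p)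
  have hs' : (fibreEquiv r E x).symm (fibreHomeo r E x p : Vec r) ≠ 0 := by simpa using hs
  have h1 : ContDiffAt ℝ ∞ (fun z : Vec r ↦ (F.onFibre x z)⁻¹ • z) (fibreHomeo r E x p) :=
    ((F.contDiffAt_onFibre x hs).inv (F.pos hs').ne').smul contDiffAt_id
  have h2 : ContMDiff (𝓡 r) 𝓘(ℝ, Vec r) ∞ fun q : SphereFibre r E x ↦
      (fibreHomeo r E x q : Vec r) :=
    ((contMDiff_coe_sphere (n := r) (E := Vec r)).of_le le_top).comp (contMDiff_fibreHomeo x)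
  exact ContMDiffAt.comp (g := fun z : Vec r ↦ (F.onFibre x z)⁻¹ • z) p h1.contMDiffAt (h2 p)

theorem fibreEquiv_dEll {x : M} (p : SphereFibre r E x) (v : TangentSpace (𝓡 r) p) :
    fibreEquiv r E x (dEll F p v) =
      mvfderiv (𝓡 r) (fun q : SphereFibre r E x ↦ fibreEquiv r E x (F.ell q)) p v := by
  rw [dEll, ← fibreEquiv_symm_apply, ContinuousLinearEquiv.apply_symm_apply]
  simp only [← fibreEquiv_apply]

end FinslerMetric
end FibreMaps

/-! ### Chain and product rules for vector-valued functions on a manifold -/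

section VectorValued

variable {H B : Type*} [NormedAddCommGroup B] [NormedSpace ℝ B] [TopologicalSpace H]
  {I : ModelWithCorners ℝ B H} {X : Type*} [TopologicalSpace X] [ChartedSpace H X]
  {V G : Type*} [NormedAddCommGroup V] [NormedSpace ℝ V] [NormedAddCommGroup G] [NormedSpace ℝ G]

theorem mvfderiv_comp_differentiableAt {f : X → V} {p : X} {φ : V → G}
    (hφ : DifferentiableAt ℝ φ (f p)) (hf : MDifferentiableAt I 𝓘(ℝ, V) f p)
    (v : TangentSpace I p) :
    mvfderiv I (fun q ↦ φ (f q)) p v = fderiv ℝ φ (f p) (mvfderiv I f p v) := by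
  have h := mfderiv_comp p hφ.mdifferentiableAt hf
  rw [mfderiv_eq_fderiv] at h
  exact DFunLike.congr_fun h v

theorem mvfderiv_clm_apply {f : X → V →L[ℝ] G} {u : X → V} {p : X}
    (hf : MDifferentiableAt I 𝓘(ℝ, V →L[ℝ] G) f p) (hu : MDifferentiableAt I 𝓘(ℝ, V) u p)
    (v : TangentSpace I p) :
    mvfderiv I (fun q ↦ f q (u q)) p v = mvfderiv I f p v (u p) + f p (mvfderiv I u p v) := by
  have h1 : mvfderiv I f p = fderivWithin ℝ (fun y ↦ f ((extChartAt I p).symm y)) (Set.range I)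
      (extChartAt I p p) := MDifferentiableAt.mvfderiv hf
  have h2 : mvfderiv I u p = fderivWithin ℝ (fun y ↦ u ((extChartAt I p).symm y)) (Set.range I)
      (extChartAt I p p) := MDifferentiableAt.mvfderiv hu
  have h3 : mvfderiv I (fun q ↦ f q (u q)) p = fderivWithin ℝ
      (fun y ↦ f ((extChartAt I p).symm y) (u ((extChartAt I p).symm y))) (Set.range I)
      (extChartAt I p p) := MDifferentiableAt.mvfderiv (hf.clm_apply hu)
  have hf' : DifferentiableWithinAt ℝ (fun y ↦ f ((extChartAt I p).symm y)) (Set.range I)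
      (extChartAt I p p) := hf.differentiableWithinAt_writtenInExtChartAt
  have hu' : DifferentiableWithinAt ℝ (fun y ↦ u ((extChartAt I p).symm y)) (Set.range I)
      (extChartAt I p p) := hu.differentiableWithinAt_writtenInExtChartAt
  have h4 := fderivWithin_clm_apply
    (show UniqueDiffWithinAt ℝ (Set.range I) (extChartAt I p p) from
      I.uniqueDiffWithinAt_image) hf' hu'
  have h5 := DFunLike.congr_fun h4 v
  rw [h1, h2, h3, add_comm]
  rw [extChartAt_to_inv] at h5
  exact h5

end VectorValued

/-! ### Derivatives along a fibre of $F(\ell)=1$ and of $g(\ell,u)=0$ -/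

section TautologicalSection

variable {m r : ℕ} {M : Type*} [TopologicalSpace M] [ChartedSpace (EuclideanSpace ℝ (Fin m)) M]
  [IsManifold (𝓡 m) ∞ M]
  {E : M → Type*} [∀ x, AddCommGroup (E x)] [∀ x, Module ℝ (E x)]
  [∀ x, TopologicalSpace (E x)] [∀ x, IsTopologicalAddGroup (E x)] [∀ x, ContinuousSMul ℝ (E x)]
  [TopologicalSpace (TotalSpace (Vec r) E)] [FiberBundle (Vec r) E] [VectorBundle ℝ (Vec r) E]
  [ContMDiffVectorBundle ∞ (Vec r) E (𝓡 m)]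
  (F : FinslerMetric m r E)

theorem mvfderiv_congr {x : M} {f h : SphereFibre r E x → ℝ} {p : SphereFibre r E x}
    (hfh : f =ᶠ[𝓝 p] h) : mvfderiv (𝓡 r) f p = mvfderiv (𝓡 r) h p := by
  ext ξ
  change (mfderiv (𝓡 r) 𝓘(ℝ, ℝ) f p ξ : ℝ) = mfderiv (𝓡 r) 𝓘(ℝ, ℝ) h p ξ
  rw [hfh.mfderiv_eq]
  rfl

/-- The image of `dℓ` is `g`-orthogonal to the tautological section. -/
theorem FinslerMetric.g_ell_dEll {x : M} (p : SphereFibre r E x) (v : TangentSpace (𝓡 r) p) :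
    F.g p (F.ell p) (dEll F p v) = 0 := by
  have h : fibreEquiv r E x (F.ell p) ≠ 0 := by simpa using F.ell_ne_zero p
  have h1 := mvfderiv_comp_differentiableAt
    (f := fun q : SphereFibre r E x ↦ fibreEquiv r E x (F.ell q)) ((F.contDiffAt_sqOnFibre x _ h).differentiableAt (by simp))
    ((F.contMDiff_fibreEquiv_ell x p).mdifferentiableAt (by simp)) v
  -- Differentiating $F^2(\ell)=1$ gives $d(F^2)_\ell(d\ell(v))=0$, which is $2g(\ell,d\ell(v))=0$.
  have h2 : (fun q : SphereFibre r E x ↦ F.sqOnFibre x (fibreEquiv r E x (F.ell q))) =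
      fun _ ↦ 1 := by
    funext q
    simp [FinslerMetric.sqOnFibre_eq, F.toFun_ell]
  rw [h2, mvfderiv_const, ← F.fibreEquiv_dEll] at h1
  rw [F.g_ell_left, ← h1]
  simp

/-- Differentiating `g(u, ℓ) = 0` along the fibre. -/
theorem FinslerMetric.g_dEll_add_g_ell_mvfderiv {x : M} {p : SphereFibre r E x}
    {u : SphereFibre r E x → Vec r} (hu : MDifferentiableAt (𝓡 r) 𝓘(ℝ, Vec r) u p)
    (hperp : ∀ᶠ q in 𝓝 p, F.g q (F.ell q) ((fibreEquiv r E x).symm (u q)) = 0)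
    (v : TangentSpace (𝓡 r) p) :
    F.g p (dEll F p v) ((fibreEquiv r E x).symm (u p)) +
      F.g p (F.ell p) ((fibreEquiv r E x).symm (mvfderiv (𝓡 r) u p v)) = 0 := by
  have h : fibreEquiv r E x (F.ell p) ≠ 0 := by simpa using F.ell_ne_zero p
  have hd : DifferentiableAt ℝ (fderiv ℝ (F.sqOnFibre x)) (fibreEquiv r E x (F.ell p)) :=
    (contDiffAt_fderiv_of_ne_zero (F.contDiffAt_sqOnFibre x) _ h).differentiableAt (by simp)
  have hl : MDifferentiableAt (𝓡 r) 𝓘(ℝ, Vec r)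
      (fun q : SphereFibre r E x ↦ fibreEquiv r E x (F.ell q)) p :=
    (F.contMDiff_fibreEquiv_ell x p).mdifferentiableAt (by simp)
  have hf : MDifferentiableAt (𝓡 r) 𝓘(ℝ, Vec r →L[ℝ] ℝ) (fun q : SphereFibre r E x ↦
      fderiv ℝ (F.sqOnFibre x) (fibreEquiv r E x (F.ell q))) p :=
    DifferentiableAt.comp_mdifferentiableAt
      (f := fun q : SphereFibre r E x ↦ fibreEquiv r E x (F.ell q)) hd hl
  have h1 := mvfderiv_clm_apply hf hu v
  -- The function $2g(\ell,u)=d(F^2)_\ell(u)$ vanishes near $p$. In the product rule `h1` its first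
  -- term is the Hessian $2g(d\ell(v),u)$, so no third derivative of $F^2$ occurs.
  have h2 : (fun q : SphereFibre r E x ↦
      fderiv ℝ (F.sqOnFibre x) (fibreEquiv r E x (F.ell q)) (u q)) =ᶠ[𝓝 p] fun _ ↦ 0 := by
    filter_upwards [hperp] with q hq
    simpa [F.g_ell_left] using hq
  rw [mvfderiv_congr h2, mvfderiv_const, mvfderiv_comp_differentiableAt
    (f := fun q : SphereFibre r E x ↦ fibreEquiv r E x (F.ell q)) hd hl,
    ← F.fibreEquiv_dEll] at h1
  rw [F.g_eq, F.g_ell_left, ContinuousLinearEquiv.apply_symm_apply,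
    ContinuousLinearEquiv.apply_symm_apply, ← mul_add, ← h1]
  simp

end TautologicalSection

/-! ### Orientation signs, Gram determinants and orthonormal bases -/

section LinearAlgebra

theorem sign_mul_of_pos {c : ℝ} (hc : 0 < c) (t : ℝ) : Real.sign (c * t) = Real.sign t := by
  simp only [Real.sign, mul_pos_iff_of_pos_left hc, ← not_le, mul_nonneg_iff_of_pos_left hc]

theorem sign_neg_one_pow_mul_mul_abs (k : ℕ) (t : ℝ) :
    Real.sign ((-1) ^ k * t) * |t| = (-1) ^ k * t := by
  have h : |t| = |(-1) ^ k * t| := by simp [abs_mul]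
  rw [h, mul_comm]
  rcases lt_trichotomy ((-1) ^ k * t) 0 with ht | ht | ht
  · simp [Real.sign_of_neg ht, abs_of_neg ht]
  · simp [ht]
  · simp [Real.sign_of_pos ht, abs_of_pos ht]

variable {k : ℕ} {V : Type*} [AddCommGroup V] [Module ℝ V]

/-- The alternating form chosen to represent the orientation is a positive multiple of `b.det`, so
the choice does not affect the sign. -/
theorem orientationSign_basis (b : Basis (Fin k) ℝ V) (u : Fin k → V) :
    orientationSign b.orientation u = Real.sign (b.det u) := by
  have h : SameRay ℝ (Module.Ray.someVector b.orientation) b.det := by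
    rw [← ray_eq_iff (Module.Ray.someVector_ne_zero _) b.det_ne_zero, Module.Ray.someVector_ray]
    rfl
  obtain ⟨c, hc, h1⟩ := h.exists_pos_right (Module.Ray.someVector_ne_zero _) b.det_ne_zero
  rw [orientationSign, h1, AlternatingMap.smul_apply, smul_eq_mul, sign_mul_of_pos hc]

variable {B : LinearMap.BilinForm ℝ V} {r : ℕ} {b : Basis (Fin k) ℝ V}

theorem repr_of_orthonormal (horth : ∀ i j, B (b i) (b j) = if i = j then 1 else 0) (w : V)
    (i : Fin k) : b.repr w i = B w (b i) := by
  conv_rhs => rw [← b.sum_repr w, map_sum, LinearMap.sum_apply]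
  simp [horth]

theorem sum_repr_mul_repr_of_orthonormal
    (horth : ∀ i j, B (b i) (b j) = if i = j then 1 else 0) (v w : V) :
    B v w = ∑ i, b.repr v i * b.repr w i := by
  conv_lhs => rw [← b.sum_repr w]
  simp [repr_of_orthonormal horth, mul_comm]

/-- Laplace expansion along the first column: only its last entry is nonzero, and its position gives
the sign $(-1)^r$. -/
theorem basis_det_cons_last (b : Basis (Fin (r + 1)) ℝ V) (w : Fin r → V) :
    b.det (Fin.cons (b (Fin.last r)) w) =
      (-1) ^ r * (Matrix.of fun i j ↦ b.repr (w j) i.castSucc).det := by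
  rw [Basis.det_apply, Matrix.det_succ_column_zero, Finset.sum_eq_single (Fin.last r)]
  · simp only [Basis.toMatrix_apply, Fin.cons_zero, Basis.repr_self, Finsupp.single_eq_same,
      Fin.val_last, mul_one, Fin.succAbove_last]
    congr 2
  · intro i _ hi
    simp [Basis.toMatrix_apply, hi.symm]
  · simp

/-- The Riemannian volume, with the outward normal `b (last r)` first, of vectors orthogonal to
that normal. -/
theorem orientationSign_mul_sqrt_gram {b : Basis (Fin (r + 1)) ℝ V}
    (horth : ∀ i j, B (b i) (b j) = if i = j then 1 else 0) (w : Fin r → V)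
    (hw : ∀ j, B (w j) (b (Fin.last r)) = 0) :
    orientationSign b.orientation (Fin.cons (b (Fin.last r)) w) *
        √(Matrix.of fun i j ↦ B (w i) (w j)).det =
      (Matrix.of fun i j : Fin r ↦ -B (w j) (b i.castSucc)).det := by
  let C : Matrix (Fin r) (Fin r) ℝ := Matrix.of fun i j ↦ b.repr (w j) i.castSucc
  -- The $w_j$ have no component along the normal, so the square block $C$ contains all their
  -- coordinates.
  have h1 : (Matrix.of fun i j ↦ B (w i) (w j)) = C.transpose * C := by
    ext i j
    simp only [Matrix.of_apply, Matrix.mul_apply, Matrix.transpose_apply, C]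
    rw [sum_repr_mul_repr_of_orthonormal horth, Fin.sum_univ_castSucc,
      repr_of_orthonormal horth (w i) (Fin.last r), hw, zero_mul, add_zero]
  have h2 : (Matrix.of fun i j : Fin r ↦ -B (w j) (b i.castSucc)) = -C := by
    ext i j
    simp [C, repr_of_orthonormal horth]
  rw [h1, h2, Matrix.det_mul, Matrix.det_transpose, Real.sqrt_mul_self_eq_abs,
    orientationSign_basis, basis_det_cons_last, sign_neg_one_pow_mul_mul_abs, Matrix.det_neg]
  simp [C]

end LinearAlgebra

/-! ### The connection forms of $\nabla$ on fibre directions -/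

section ConnectionForm

variable {m r : ℕ} {M : Type*} [TopologicalSpace M] [ChartedSpace (EuclideanSpace ℝ (Fin m)) M]
  [IsManifold (𝓡 m) ∞ M]
  {E : M → Type*} [∀ x, AddCommGroup (E x)] [∀ x, Module ℝ (E x)]
  [∀ x, TopologicalSpace (E x)] [∀ x, IsTopologicalAddGroup (E x)] [∀ x, ContinuousSMul ℝ (E x)]
  [TopologicalSpace (TotalSpace (Vec r) E)] [FiberBundle (Vec r) E] [VectorBundle ℝ (Vec r) E]
  [ContMDiffVectorBundle ∞ (Vec r) E (𝓡 m)]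
  (F : FinslerMetric m r E) (N : EhresmannConnection m r E) (D : Connection m r E)

theorem sum_smul_frame (x : M) (z : Vec r) :
    ∑ i, z i • frame (r := r) (E := E) x i x = (fibreEquiv r E x).symm z := by
  have h1 : ∑ i, z i • EuclideanSpace.single i (1 : ℝ) = z := by
    ext j
    simp [Finset.sum_apply, Pi.single_apply]
  conv_rhs => rw [← h1, map_sum]
  simp only [map_smul]
  rfl

/-- `A^j_{ik} g(𝔰_j, ℓ) = 0`. -/
theorem sum_cartanUp_mul_g_ell (p : SphereBundle r E) (i k : Fin (r + 1)) :
    ∑ j, cartanUp F p j i k * F.g p.2 (frame (r := r) p.1 j p.1) (F.ell p.2) = 0 := by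
  obtain ⟨x, p⟩ := p
  dsimp only
  let s : Fin (r + 1) → E x := fun a ↦ frame (r := r) x a x
  let G : Matrix (Fin (r + 1)) (Fin (r + 1)) ℝ := Matrix.of fun a b ↦ F.g p (s a) (s b)
  have hG : ∀ z : Vec r, ∀ a, (G.mulVec z) a = F.g p (s a) ((fibreEquiv r E x).symm z) := by
    intro z a
    rw [← sum_smul_frame, ← F.gForm_apply, map_sum]
    simp only [map_smul, smul_eq_mul]
    change ∑ b, F.g p (s a) (s b) * z b = ∑ b, z b * F.g p (s a) (s b)
    exact Finset.sum_congr rfl fun b _ ↦ mul_comm (F.g p (s a) (s b)) (z b)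
  have hsymm : G.transpose = G := by
    ext a b
    exact F.g_comm p _ _
  -- The inverse of the Gram matrix is meaningful by positive definiteness: a kernel vector $z$
  -- would satisfy $g(z,z)=0$.
  have hunit : IsUnit G.det := by
    rw [← Matrix.isUnit_iff_isUnit_det, ← Matrix.mulVec_injective_iff_isUnit]
    refine (injective_iff_map_eq_zero G.mulVecLin).2 fun a ha ↦ ?_
    let z : Vec r := WithLp.toLp 2 a
    by_contra hne
    have hz : (fibreEquiv r E x).symm z ≠ 0 := by simpa [z] using hne
    have h1 := F.pos_def x (F.ell p) _ (F.ell_ne_zero p) hz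
    change 0 < F.g p _ _ at h1
    have h2 : ∀ b, F.g p (s b) ((fibreEquiv r E x).symm z) = 0 := fun b ↦ by
      rw [← hG]; exact congrFun ha b
    nth_rw 1 [← sum_smul_frame x z] at h1
    rw [← F.gForm_apply, map_sum, LinearMap.sum_apply] at h1
    simp [F.gForm_apply] at h1
    simp [s] at h2
    simp [h2] at h1
  let z : Vec r := fibreEquiv r E x (F.ell p)
  have hz : ∑ l, z l • s l = F.ell p := by
    rw [sum_smul_frame]; simp [z]
  -- Raising the index of $g(\cdot,\ell)$ recovers the components $\ell^l$, so the sum becomes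
  -- $A(\ell,\mathfrak s_i,\mathfrak s_k)$.
  have h1 : ∀ l, ∑ j, G⁻¹ j l * F.g p (s j) (F.ell p) = z l := by
    intro l
    have h2 : Matrix.vecMul (G.mulVec z) G⁻¹ = z := by
      rw [← Matrix.vecMul_transpose, hsymm, Matrix.vecMul_vecMul, Matrix.mul_nonsing_inv _ hunit,
        Matrix.vecMul_one]
    rw [← congrFun h2 l]
    simp only [Matrix.vecMul, dotProduct, hG]
    exact Finset.sum_congr rfl fun j _ ↦ by simp [z, mul_comm]
  calc ∑ j, cartanUp F ⟨x, p⟩ j i k * F.g p (s j) (F.ell p)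
      = ∑ j, ∑ l, G⁻¹ j l * F.g p (s j) (F.ell p) * F.cartan p (s l) (s i) (s k) :=
        Finset.sum_congr rfl fun j _ ↦ by
          rw [cartanUp, Finset.sum_mul]
          exact Finset.sum_congr rfl fun l _ ↦ mul_right_comm _ _ _
    _ = ∑ l, z l * F.cartan p (s l) (s i) (s k) := by
        rw [Finset.sum_comm]
        exact Finset.sum_congr rfl fun l _ ↦ by rw [← Finset.sum_mul, h1]
    _ = 0 := F.sum_cartan_eq_zero p _ s hz _ _

/-- On vertical vectors, `∇ 𝔰_i` is `g`-orthogonal to the tautological section. -/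
theorem g_modifiedFrame_ell (c : ℝ) {x : M} (p : SphereFibre r E x) (i : Fin (r + 1))
    (v : TangentSpace (𝓡 r) p) :
    F.g p (modifiedFrame F N D c (fibreInclusion r E x p) i
      (mfderiv (𝓡 r) ((𝓡 m).prod (𝓡 r)) (fibreInclusion r E x) p v)) (F.ell p) = 0 := by
  let P := fibreInclusion r E x p
  set ξ := mfderiv (𝓡 r) ((𝓡 m).prod (𝓡 r)) (fibreInclusion r E x) p v with hξ
  let Λ : PullbackBundle m r E P →ₗ[ℝ] ℝ := (F.gForm p).flip (F.ell p)
  change Λ (modifiedFrame F N D c P i ξ) = 0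
  have h1 : modifiedFrame F N D c P i ξ =
      ∑ j, (∑ k, c * cartanUp F P j i k * deltaY F N P k ξ) • pullbackFrame P.1 j P := by
    -- Here $D$ drops out, since it enters only through the horizontal part of the vector.
    have h0 : N.hor P ξ = 0 := N.hor_fibreInclusion p v
    rw [modifiedFrame]
    simp [h0]
  rw [h1, map_sum]
  simp only [map_smul, smul_eq_mul, Finset.sum_mul]
  rw [Finset.sum_comm]
  refine Finset.sum_eq_zero fun k _ ↦ ?_
  have h2 := sum_cartanUp_mul_g_ell F P i k
  rw [← mul_zero (c * deltaY F N P k ξ), ← h2, Finset.mul_sum]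
  refine Finset.sum_congr rfl fun j _ ↦ ?_
  change _ * F.g p (frame (r := r) x j x) (F.ell p) =
    _ * (_ * F.g p (frame (r := r) x j x) (F.ell p))
  ring

theorem modifiedConnection_apply (c : ℝ) (σ : ∀ q : SphereBundle r E, PullbackBundle m r E q)
    (P : SphereBundle r E) (ξ : TangentSpace ((𝓡 m).prod (𝓡 r)) P) :
    modifiedConnection F N D c σ P ξ = ∑ i, (mvfderiv ((𝓡 m).prod (𝓡 r))
      (fun q : SphereBundle r E ↦ components P.1 σ q i) P ξ • pullbackFrame P.1 i P +
    components P.1 σ P i • modifiedFrame F N D c P i ξ) := by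
  change (∑ i, ((mvfderiv ((𝓡 m).prod (𝓡 r))
      (fun q : SphereBundle r E ↦ components P.1 σ q i) P).smulRight (pullbackFrame P.1 i P) +
    components P.1 σ P i • modifiedFrame F N D c P i) :
      TangentSpace ((𝓡 m).prod (𝓡 r)) P →L[ℝ] PullbackBundle m r E P) ξ = _
  rw [sum_apply]
  rfl

theorem mdifferentiableAt_components_fibreInclusion {x : M} (p : SphereFibre r E x)
    {σ : ∀ q : SphereBundle r E, PullbackBundle m r E q}
    (hσ : MDifferentiableAt ((𝓡 m).prod (𝓡 r)) (((𝓡 m).prod (𝓡 r)).prod 𝓘(ℝ, Vec r))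
      (fun q ↦ TotalSpace.mk' (Vec r) q (σ q)) (fibreInclusion r E x p)) :
    MDifferentiableAt (𝓡 r) 𝓘(ℝ, Vec r) (fun q : SphereFibre r E x ↦
      components (m := m) x σ (fibreInclusion r E x q)) p :=
  MDifferentiableAt.comp (g := fun q : SphereBundle r E ↦ components (m := m) x σ q) p
    ((mdifferentiableAt_section _ _).1 hσ)
    ((contMDiff_fibreInclusion (m := m) (E := E) x p).mdifferentiableAt (by simp))

/-- The chain rule along $i_x$. The components refer to one trivialisation over $x$ for the whole
fibre, so no change of frame intervenes. -/
theorem mvfderiv_component_fibreInclusion {x : M} (p : SphereFibre r E x)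
    {σ : ∀ q : SphereBundle r E, PullbackBundle m r E q}
    (hσ : MDifferentiableAt ((𝓡 m).prod (𝓡 r)) (((𝓡 m).prod (𝓡 r)).prod 𝓘(ℝ, Vec r))
      (fun q ↦ TotalSpace.mk' (Vec r) q (σ q)) (fibreInclusion r E x p))
    (v : TangentSpace (𝓡 r) p) (i : Fin (r + 1)) :
    mvfderiv ((𝓡 m).prod (𝓡 r)) (fun q : SphereBundle r E ↦ components x σ q i)
        (fibreInclusion r E x p)
        (mfderiv (𝓡 r) ((𝓡 m).prod (𝓡 r)) (fibreInclusion r E x) p v) =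
      mvfderiv (𝓡 r) (fun q : SphereFibre r E x ↦
        components (m := m) x σ (fibreInclusion r E x q)) p v i := by
  have h2 := mvfderiv_comp_apply (g := fun q : SphereBundle r E ↦ components x σ q i) p
    (mdifferentiableAt_components hσ i)
    ((contMDiff_fibreInclusion (m := m) (E := E) x p).mdifferentiableAt (by simp)) v
  have h3 := mvfderiv_comp_differentiableAt (φ := (EuclideanSpace.proj i : Vec r →L[ℝ] ℝ))
    (ContinuousLinearMap.differentiableAt _) (mdifferentiableAt_components_fibreInclusion p hσ) v
  rw [ContinuousLinearMap.fderiv] at h3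
  exact h2.symm.trans h3

/-- On vertical vectors, the `ℓ`-component of `∇ σ` is that of the derivative of `σ` along the
fibre. -/
theorem g_modifiedConnection_ell (c : ℝ) {x : M} (p : SphereFibre r E x)
    {σ : ∀ q : SphereBundle r E, PullbackBundle m r E q}
    (hσ : MDifferentiableAt ((𝓡 m).prod (𝓡 r)) (((𝓡 m).prod (𝓡 r)).prod 𝓘(ℝ, Vec r))
      (fun q ↦ TotalSpace.mk' (Vec r) q (σ q)) (fibreInclusion r E x p))
    (v : TangentSpace (𝓡 r) p) :
    F.g p (modifiedConnection F N D c σ (fibreInclusion r E x p)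
      (mfderiv (𝓡 r) ((𝓡 m).prod (𝓡 r)) (fibreInclusion r E x) p v)) (F.ell p) =
    F.g p ((fibreEquiv r E x).symm (mvfderiv (𝓡 r) (fun q : SphereFibre r E x ↦
      components (m := m) x σ (fibreInclusion r E x q)) p v)) (F.ell p) := by
  let Λ : PullbackBundle m r E (fibreInclusion r E x p) →ₗ[ℝ] ℝ := (F.gForm p).flip (F.ell p)
  let Λ' : E x →ₗ[ℝ] ℝ := (F.gForm p).flip (F.ell p)
  set ξ := mfderiv (𝓡 r) ((𝓡 m).prod (𝓡 r)) (fibreInclusion r E x) p v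
  set u' : Vec r := mvfderiv (𝓡 r) (fun q : SphereFibre r E x ↦
      components (m := m) x σ (fibreInclusion r E x q)) p v
  change Λ (modifiedConnection F N D c σ (fibreInclusion r E x p) ξ) =
    Λ' ((fibreEquiv r E x).symm u')
  rw [modifiedConnection_apply, ← sum_smul_frame, map_sum, map_sum]
  refine Finset.sum_congr rfl fun i _ ↦ ?_
  have h1 : Λ (modifiedFrame F N D c (fibreInclusion r E x p) i ξ) = 0 :=
    g_modifiedFrame_ell F N D c p i v
  rw [map_add, map_smul, map_smul, map_smul, h1, smul_zero, add_zero]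
  exact congrArg (· • Λ' (frame x i x)) (mvfderiv_component_fibreInclusion p hσ v i)

/-- The connection forms `ϖ_i^n` on vertical vectors. -/
theorem connectionForm_last_fibreInclusion (c : ℝ) {W : Set (SphereBundle r E)} (hW : IsOpen W)
    {e : Fin (r + 1) → ∀ q : SphereBundle r E, PullbackBundle m r E q}
    (he : IsLocalFrameOn ((𝓡 m).prod (𝓡 r)) (Vec r) ∞ e W)
    (horth : ∀ q ∈ W, ∀ i j, F.g q.2 (e i q) (e j q) = if i = j then 1 else 0)
    (hlast : ∀ q ∈ W, e (Fin.last r) q = F.ellSection q) {x : M} (p : SphereFibre r E x)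
    (hp : fibreInclusion r E x p ∈ W) {i : Fin (r + 1)} (hi : i ≠ Fin.last r)
    (v : TangentSpace (𝓡 r) p) :
    connectionForm (modifiedConnection F N D c) he i (Fin.last r) (fibreInclusion r E x p)
        (mfderiv (𝓡 r) ((𝓡 m).prod (𝓡 r)) (fibreInclusion r E x) p v) =
      -F.g p (dEll F p v) (e i (fibreInclusion r E x p)) := by
  have hsmooth : MDifferentiableAt ((𝓡 m).prod (𝓡 r)) (((𝓡 m).prod (𝓡 r)).prod 𝓘(ℝ, Vec r))
      (fun q ↦ TotalSpace.mk' (Vec r) q (e i q)) (fibreInclusion r E x p) :=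
    (he.contMDiffAt hW hp i).mdifferentiableAt (by simp)
  let b : Basis (Fin (r + 1)) ℝ (E x) := he.toBasisAt hp
  have hb : ∀ j, b j = e j (fibreInclusion r E x p) := he.toBasisAt_coe hp
  have hborth : ∀ j k, F.gForm p (b j) (b k) = if j = k then 1 else 0 := fun j k ↦ by
    rw [hb, hb]; exact horth _ hp j k
  -- In an orthonormal frame the dual coefficient of $e_n=\ell$ is the pairing with $\ell$.
  have hcoeff : ∀ w : E x, he.coeff (Fin.last r) (fibreInclusion r E x p) w =
      F.g p w (F.ell p) := fun w ↦ by
    have h1 : he.coeff (Fin.last r) (fibreInclusion r E x p) w = b.repr w (Fin.last r) := by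
      rw [IsLocalFrameOn.coeff, dif_pos hp]
      rfl
    rw [h1, repr_of_orthonormal hborth, hb, hlast _ hp]
    rfl
  refine ((hcoeff _).trans (g_modifiedConnection_ell F N D c p hsmooth v)).trans ?_
  rw [F.g_comm]
  have hcomp : ∀ q : SphereFibre r E x, (fibreEquiv r E x).symm
      (components (m := m) x (e i) (fibreInclusion r E x q)) = e i (fibreInclusion r E x q) :=
    fun q ↦ by
      have h2 : components (m := m) x (e i) (fibreInclusion r E x q) =
        fibreEquiv r E x (e i (fibreInclusion r E x q)) := (fibreEquiv_apply x _).symm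
      rw [h2]
      exact (fibreEquiv r E x).symm_apply_apply _
  -- Orthogonality at $p$ alone could not be differentiated; it holds nearby because $W$ is open.
  have hperp : ∀ᶠ q in 𝓝 p, F.g q (F.ell q) ((fibreEquiv r E x).symm
      (components (m := m) x (e i) (fibreInclusion r E x q))) = 0 := by
    filter_upwards [(contMDiff_fibreInclusion (m := m) (E := E) x).continuous.continuousAt
      (hW.mem_nhds hp)] with q hq
    rw [hcomp]
    refine (F.g_comm q _ _).trans ?_
    have h3 := horth _ hq i (Fin.last r)
    rw [hlast _ hq, if_neg hi] at h3
    exact h3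
  have h4 := F.g_dEll_add_g_ell_mvfderiv (mdifferentiableAt_components_fibreInclusion p hsmooth) hperp v
  rw [hcomp] at h4
  exact eq_neg_of_add_eq_zero_right h4

end ConnectionForm

end FinslerGBC
end
-- The volume form as a wedge product of connection forms
theorem mainTheorem4 {m r : ℕ} {M : Type*} [TopologicalSpace M]
    [ChartedSpace (EuclideanSpace ℝ (Fin m)) M] [IsManifold (𝓡 m) ∞ M]
    {E : M → Type*} [∀ x, AddCommGroup (E x)] [∀ x, Module ℝ (E x)]
    [∀ x, TopologicalSpace (E x)] [∀ x, IsTopologicalAddGroup (E x)]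
    [∀ x, ContinuousSMul ℝ (E x)]
    [TopologicalSpace (TotalSpace (FinslerGBC.Vec r) E)] [FiberBundle (FinslerGBC.Vec r) E]
    [VectorBundle ℝ (FinslerGBC.Vec r) E]
    [ContMDiffVectorBundle ∞ (FinslerGBC.Vec r) E (𝓡 m)]
    (F : FinslerGBC.FinslerMetric m r E) (N : FinslerGBC.EhresmannConnection m r E)
    (D : FinslerGBC.Connection m r E) (hDsmooth : CovariantDerivative.ContMDiffCovariantDerivative D ∞)
    (hD : FinslerGBC.IsMetricCompatible F D) (c : ℝ)
    (W : Set (FinslerGBC.SphereBundle r E)) (hW : IsOpen W)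
    (e : Fin (r + 1) → ∀ q : FinslerGBC.SphereBundle r E, FinslerGBC.PullbackBundle m r E q)
    (he : IsLocalFrameOn ((𝓡 m).prod (𝓡 r)) (FinslerGBC.Vec r) ∞ e W)
    (horth : ∀ q ∈ W, ∀ i j, F.g q.2 (e i q) (e j q) = if i = j then 1 else 0)
    (hlast : ∀ q ∈ W, e (Fin.last r) q = F.ellSection q)
    (x : M) (o : Orientation ℝ (E x) (Fin (r + 1))) (p : FinslerGBC.SphereFibre r E x)
    (hp : FinslerGBC.fibreInclusion r E x p ∈ W) (ho : (he.toBasisAt hp).orientation = o)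
    (v : Fin r → TangentSpace (𝓡 r) p) :
    FinslerGBC.fibreVolume F o p v =
      FinslerGBC.fibrePullback p (FinslerGBC.wedge fun α : Fin r ↦
        FinslerGBC.connectionForm (FinslerGBC.modifiedConnection F N D c) he α.castSucc
          (Fin.last r) (FinslerGBC.fibreInclusion r E x p)) v := by

  let b : Basis (Fin (r + 1)) ℝ (E x) := he.toBasisAt hp
  have hb : ∀ j, b j = e j (FinslerGBC.fibreInclusion r E x p) := he.toBasisAt_coe hp
  have hborth : ∀ j k, F.gForm p (b j) (b k) = if j = k then 1 else 0 := fun j k ↦ by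
    rw [hb, hb]; exact horth _ hp j k
  have hblast : b (Fin.last r) = F.ell p := (hb _).trans (hlast _ hp)
  have hbo : b.orientation = o := ho
  -- With $w_j=d\ell(v_j)$, this turns the volume into $\det(-g(d\ell(v_j),e_i))$. It then remains
  -- to match the entries with $\varpi_i^n(v_j)$.
  have h1 := FinslerGBC.orientationSign_mul_sqrt_gram hborth
    (fun j ↦ FinslerGBC.dEll F p (v j)) fun j ↦ by
      rw [hblast, F.gForm_apply, F.g_comm, F.g_ell_dEll]
  rw [hblast, hbo] at h1
  refine h1.trans ?_
  rw [FinslerGBC.fibrePullback, AlternatingMap.compLinearMap_apply, FinslerGBC.wedge_apply]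
  congr 2
  ext i j
  have h2 := FinslerGBC.connectionForm_last_fibreInclusion F N D c hW he horth hlast p hp
    (Fin.castSucc_ne_last i) (v j)
  rw [hb]
  exact h2.symm
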